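/- Let $F$ be an algebraically closed field of characteristic different from $2$. A Lie-Jordan algebra over $F$ is an $F$-vector space $A$ with a bilinear operation $[x,y]$ and a trilinear operation $T(x,y,z)$ satisfying $$[x,y]=-[y,x],\qquad T(x,y,z)=T(z,y,x),\qquad [[x,y],z]=T(x,y,z)-T(y,x,z),$$ $$[t,T(x,y,z)]=T([t,x],y,z)+T(x,[t,y],z)+T(x,y,[t,z]),$$ $$T(T(x,y,z),t,v)=T(T(x,t,v),y,z)-T(x,T(y,v,t),z)+T(x,y,T(z,t,v)).$$ An ideal of $A$ is a subspace $I$ such that $[x,y]\in I$ and $T(x,y,z)\in I$ whenever at least one of the arguments lies in $I$. The algebra $A$ is simple if its two operations are not both identically zero and its only ideals are $0$ and $A$. An isomorphism is a linear bijection that preserves both operations. For an associative $F$-algebra $R$ with an ($F$-linear) involution $*$, the space $K(R,*)=\{a\in R : a^*=-a\}$ is a Lie-Jordan algebra with the operations $[a,b]=ab-ba$ and $T(a,b,c)=abc+cba$. Let $A$ be a finite-dimensional simple Lie-Jordan algebra over $F$. Then $A$ is isomorphic to one of the following algebras: - $K(M_n(F),{}')$ for some $n>2$, where $a\mapsto a'$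 is the transposition; - $K(M_{2n}(F),\mathrm{sp})$ for some $n\ge 1$, where $\mathrm{sp}(a)=J^{-1}a^{T}J$ with $J=\begin{pmatrix}0&-I_n\\ I_n&0\end{pmatrix}$ is the symplectic involution; - $M_n(F)$ for some $n\ge 1$, with the operations $[a,b]=ab-ba$ and $T(a,b,c)=abc+cba$. -/

import Mathlib

/-- A Lie-Jordan algebra structure on an `F`-module `A`: a bilinear operation `[x, y]` and a
trilinear operation `T(x, y, z)` satisfying the five defining identities. -/
structure LieJordan (F : Type*) (A : Type*) [CommRing F] [AddCommGroup A] [Module F A] where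
  /-- the bilinear operation `[x, y]` -/
  br : A →ₗ[F] A →ₗ[F] A
  /-- the trilinear operation `T(x, y, z)` -/
  tr : A →ₗ[F] A →ₗ[F] A →ₗ[F] A
  br_skew : ∀ x y, br x y = -br y x
  tr_symm : ∀ x y z, tr x y z = tr z y x
  br_br : ∀ x y z, br (br x y) z = tr x y z - tr y x z
  br_tr : ∀ t x y z,
    br t (tr x y z) = tr (br t x) y z + tr x (br t y) z + tr x y (br t z)
  tr_tr : ∀ x y z t v,
    tr (tr x y z) t v = tr (tr x t v) y z - tr x (tr y v t) z + tr x y (tr z t v)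

namespace LieJordan

variable {F : Type*} {A : Type*} [CommRing F] [AddCommGroup A] [Module F A]

/-- A subspace `I` is an ideal if a value of either operation lies in `I` as soon as at least one
of the arguments does. -/
structure IsIdeal (L : LieJordan F A) (I : Submodule F A) : Prop where
  br_left : ∀ x y, x ∈ I → L.br x y ∈ I
  br_right : ∀ x y, y ∈ I → L.br x y ∈ I
  tr_left : ∀ x y z, x ∈ I → L.tr x y z ∈ I
  tr_mid : ∀ x y z, y ∈ I → L.tr x y z ∈ I
  tr_right : ∀ x y z, z ∈ I → L.tr x y z ∈ I

/-- Simplicity: the operations are not both identically zero, and the only ideals are `0` and the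
whole algebra. -/
structure IsSimple (L : LieJordan F A) : Prop where
  nonzero : (∃ x y, L.br x y ≠ 0) ∨ (∃ x y z, L.tr x y z ≠ 0)
  eq_bot_or_eq_top : ∀ I : Submodule F A, L.IsIdeal I → I = ⊥ ∨ I = ⊤

/-- Two Lie-Jordan algebras are isomorphic if some linear bijection preserves both operations. -/
def Isomorphic {B : Type*} [AddCommGroup B] [Module F B]
    (L : LieJordan F A) (M : LieJordan F B) : Prop :=
  ∃ e : A ≃ₗ[F] B, (∀ x y, e (L.br x y) = M.br (e x) (e y)) ∧
    ∀ x y z, e (L.tr x y z) = M.tr (e x) (e y) (e z)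

/-- An associative algebra `R` with `[a, b] = ab - ba` and `T(a, b, c) = abc + cba`. -/
def ofAssoc (F : Type*) (R : Type*) [CommRing F] [Ring R] [Algebra F R] : LieJordan F R where
  br := LinearMap.mk₂ F (fun a b => a * b - b * a)
    (fun a a' b => by noncomm_ring) (fun c a b => by simp [smul_sub])
    (fun a b b' => by noncomm_ring) (fun c a b => by simp [smul_sub])
  tr := LinearMap.mk₂ F
    (fun a b =>
      { toFun := fun c => a * b * c + c * b * a
        map_add' := fun c c' => by noncomm_ring
        map_smul' := fun r c => by simp })
    (fun a a' b => by ext c; simp; noncomm_ring)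
    (fun r a b => by ext c; simp)
    (fun a b b' => by ext c; simp; noncomm_ring)
    (fun r a b => by ext c; simp)
  br_skew x y := by simp
  tr_symm x y z := by simp; noncomm_ring
  br_br x y z := by simp; noncomm_ring
  br_tr t x y z := by simp; noncomm_ring
  tr_tr x y z t v := by simp; noncomm_ring

@[simp] theorem ofAssoc_br {R : Type*} [Ring R] [Algebra F R] (a b : R) :
    (ofAssoc F R).br a b = a * b - b * a := rfl

@[simp] theorem ofAssoc_tr {R : Type*} [Ring R] [Algebra F R] (a b c : R) :
    (ofAssoc F R).tr a b c = a * b * c + c * b * a := rfl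

end LieJordan

/-- An involution of an associative `F`-algebra `R`: an `F`-linear anti-automorphism whose square
is the identity. -/
structure AlgInvolution (F : Type*) (R : Type*) [CommRing F] [Ring R] [Algebra F R] where
  /-- the underlying linear map `a ↦ a*` -/
  map : R →ₗ[F] R
  map_mul : ∀ a b, map (a * b) = map b * map a
  map_map : ∀ a, map (map a) = a

namespace AlgInvolution

variable {F : Type*} {R : Type*} [CommRing F] [Ring R] [Algebra F R]

/-- The space `K(R, *) = {a | a* = -a}` of skew-symmetric elements. -/
def skew (σ : AlgInvolution F R) : Submodule F R where
  carrier := {a | σ.map a = -a}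
  add_mem' {a b} ha hb := by
    change σ.map (a + b) = -(a + b)
    rw [map_add, show σ.map a = -a from ha, show σ.map b = -b from hb]; abel
  zero_mem' := by
    change σ.map 0 = -0
    simp
  smul_mem' c a ha := by
    change σ.map (c • a) = -(c • a)
    rw [map_smul, show σ.map a = -a from ha, smul_neg]

theorem mem_skew {σ : AlgInvolution F R} {a : R} : a ∈ σ.skew ↔ σ.map a = -a := Iff.rfl

theorem br_mem (σ : AlgInvolution F R) {a b : R} (ha : a ∈ σ.skew) (hb : b ∈ σ.skew) :
    a * b - b * a ∈ σ.skew := by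
  rw [mem_skew] at *
  rw [map_sub, σ.map_mul, σ.map_mul, ha, hb]; noncomm_ring

theorem tr_mem (σ : AlgInvolution F R) {a b c : R} (ha : a ∈ σ.skew) (hb : b ∈ σ.skew)
    (hc : c ∈ σ.skew) : a * b * c + c * b * a ∈ σ.skew := by
  rw [mem_skew] at *
  rw [map_add, σ.map_mul, σ.map_mul, σ.map_mul, σ.map_mul, ha, hb, hc]; noncomm_ring

/-- The Lie-Jordan algebra `K(R, *)` of skew-symmetric elements, with `[a, b] = ab - ba` and
`T(a, b, c) = abc + cba`. -/
def K (σ : AlgInvolution F R) : LieJordan F σ.skew where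
  br := LinearMap.mk₂ F (fun a b => ⟨(a : R) * b - b * a, σ.br_mem a.2 b.2⟩)
    (fun a a' b => by ext; simp; noncomm_ring) (fun c a b => by ext; simp [smul_sub])
    (fun a b b' => by ext; simp; noncomm_ring) (fun c a b => by ext; simp [smul_sub])
  tr := LinearMap.mk₂ F
    (fun a b =>
      { toFun := fun c => ⟨(a : R) * b * c + c * b * a, σ.tr_mem a.2 b.2 c.2⟩
        map_add' := fun c c' => by ext; simp; noncomm_ring
        map_smul' := fun r c => by ext; simp })
    (fun a a' b => by ext c; simp; noncomm_ring)
    (fun r a b => by ext c; simp)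
    (fun a b b' => by ext c; simp; noncomm_ring)
    (fun r a b => by ext c; simp)
  br_skew x y := by ext; simp
  tr_symm x y z := by ext; simp; noncomm_ring
  br_br x y z := by ext; simp; noncomm_ring
  br_tr t x y z := by ext; simp; noncomm_ring
  tr_tr x y z t v := by ext; simp; noncomm_ring

@[simp] theorem K_br (σ : AlgInvolution F R) (a b : σ.skew) :
    ((σ.K.br a b : σ.skew) : R) = a * b - b * a := rfl

@[simp] theorem K_tr (σ : AlgInvolution F R) (a b c : σ.skew) :
    ((σ.K.tr a b c : σ.skew) : R) = a * b * c + c * b * a := rfl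

end AlgInvolution

/-- The transposition `a ↦ aᵀ` on `M_n(F)`. -/
def transposeInvolution (F : Type*) [CommRing F] (n : ℕ) :
    AlgInvolution F (Matrix (Fin n) (Fin n) F) where
  map :=
    { toFun := fun a => a.transpose
      map_add' := fun a b => Matrix.transpose_add a b
      map_smul' := fun c a => Matrix.transpose_smul c a }
  map_mul a b := Matrix.transpose_mul a b
  map_map a := Matrix.transpose_transpose a

/-- The symplectic involution `a ↦ J⁻¹ aᵀ J` on `M_{2n}(F)`, where `J` is the block matrix
with blocks `0, -1, 1, 0` (the rows and columns are indexed by `Fin n ⊕ Fin n`). -/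
noncomputable def symplecticInvolution (F : Type*) [CommRing F] (n : ℕ) :
    AlgInvolution F (Matrix (Fin n ⊕ Fin n) (Fin n ⊕ Fin n) F) where
  map :=
    { toFun := fun a => (Matrix.J (Fin n) F)⁻¹ * a.transpose * Matrix.J (Fin n) F
      map_add' := fun a b => by
        simp [Matrix.mul_add, Matrix.add_mul]
      map_smul' := fun c a => by simp }
  map_mul a b := by
    have h := Matrix.J_squared (Fin n) F
    simp only [LinearMap.coe_mk, AddHom.coe_mk, Matrix.J_inv, Matrix.transpose_mul]
    have : ∀ x y : Matrix (Fin n ⊕ Fin n) (Fin n ⊕ Fin n) F,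
        x * (Matrix.J (Fin n) F * (Matrix.J (Fin n) F * y)) = -(x * y) := by
      intro x y
      rw [← Matrix.mul_assoc (Matrix.J (Fin n) F), h]; simp
    simp [Matrix.mul_assoc, this]
  map_map a := by
    have h := Matrix.J_squared (Fin n) F
    simp only [LinearMap.coe_mk, AddHom.coe_mk, Matrix.J_inv, Matrix.transpose_mul,
      Matrix.transpose_neg, Matrix.J_transpose, Matrix.transpose_transpose]
    have : Matrix.J (Fin n) F * (Matrix.J (Fin n) F * (a * (Matrix.J (Fin n) F *
        Matrix.J (Fin n) F))) = a := by
      rw [← Matrix.mul_assoc, h]; simp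
    simpa [Matrix.mul_assoc] using this

/-!
Every Lie-Jordan algebra `A` over a field of characteristic not `2` is special. If `A` were the space
of skew elements of an associative algebra `R` with involution, generated by `A`, then `R` would be
`A ⊕ H` up to scalars, `H` being spanned by the anticommutators `a ∘ b = ab + ba`, and `a ∘ b` would
act on `A` by `x ↦ (a ∘ b) ∘ x = T(a, b, x) + T(b, a, x)`. These operators (`LieJordan.anti`) make
sense in any `A`; so let `H` be their span in `End A` and let `a` act on `A × H` by the formula for
left multiplication, as half the sum of the commutation operator `E a` and the anticommutation
operator `P a`. That this respects both operations comes down to a few identities: the commutation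
rules `[E a, E b] = E [a, b]`, `[E a, P b] = P [a, b]`, `[P a, P b] = E [a, b]`, and, on the summand
`A` only, `a²c + ca² = T(a, a, c)` (`doubled_leftMul_tr`). By the commutation rules `P y` acts as a
derivation on left multiplications, and `H` is spanned by the images of `A` under the `P y`; hence
the defect of the triple product vanishes on `H` as soon as it vanishes on `A` (`trDefect_eq_zero`).

For simple `A` this action is faithful. A faithful representation of least dimension is irreducible
(`IsSimple.exists_irreducible`), because otherwise `A` would kill an invariant subspace and its
quotient, and all products would vanish. By Burnside's theorem `A` then generates a matrix algebra
`M_n(F)`. Write `K` for the image of `A` and `S` for the span of `1` and the anticommutators of `K`.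
Then `K + S = M_n(F)`, and `K ∩ S` is an ideal of `A`. If it is zero, changing the sign on `K` is an
involution whose space of skew elements is `K`; if it is `A`, then `S = M_n(F)`, which makes `K` a
nonzero two-sided ideal, so `K = M_n(F)` (`IsSimple.range_eq_top_or_skew`).

Finally, automorphisms of `M_n(F)` being inner, an involution is adjoint to a symmetric or
skew-symmetric invertible matrix (`AlgInvolution.exists_form`), which is congruent to the identity or
to the standard symplectic matrix. Skew-symmetric matrices of size at most two commute, so they
generate `M_n(F)` only in the trivial case `n = 1`, where they vanish; this gives `n > 2`.
-/

namespace LieJordan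

variable {F : Type*} {A : Type*} [Field F] [AddCommGroup A] [Module F A]

/-! ### Operator identities -/

/-- A linear map into an associative algebra that carries `[x, y]` to `xy - yx` and `T(x, y, z)`
to `xyz + zyx`. -/
structure IsSpecialization (L : LieJordan F A) {R : Type*} [Ring R] [Algebra F R]
    (ρ : A →ₗ[F] R) : Prop where
  map_br : ∀ x y, ρ (L.br x y) = ρ x * ρ y - ρ y * ρ x
  map_tr : ∀ x y z, ρ (L.tr x y z) = ρ x * ρ y * ρ z + ρ z * ρ y * ρ x

/-- The operator `T(a, b, ·) + T(b, a, ·)`. In a special Lie-Jordan algebra it is the anticommutator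
with `ab + ba`. -/
def anti (L : LieJordan F A) : A →ₗ[F] A →ₗ[F] Module.End F A := L.tr + L.tr.flip

theorem anti_apply (L : LieJordan F A) (a b : A) : L.anti a b = L.tr a b + L.tr b a := rfl

theorem anti_apply_apply (L : LieJordan F A) (a b c : A) :
    L.anti a b c = L.tr a b c + L.tr b a c := rfl

theorem anti_comm (L : LieJordan F A) (a b : A) : L.anti a b = L.anti b a := add_comm _ _

/-- The span of the operators `anti a b`. It plays the role of the symmetric part of an associative
envelope. -/
def antiSpan (L : LieJordan F A) : Submodule F (Module.End F A) :=
  Submodule.span F {h | ∃ a b, L.anti a b = h}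

theorem anti_mem (L : LieJordan F A) (a b : A) : L.anti a b ∈ L.antiSpan :=
  Submodule.subset_span ⟨a, b, rfl⟩

theorem br_mul_tr_sub (L : LieJordan F A) (t x y : A) :
    L.br t * L.tr x y - L.tr x y * L.br t = L.tr (L.br t x) y + L.tr x (L.br t y) := by
  ext z
  simp [L.br_tr]

theorem br_mul_anti_sub (L : LieJordan F A) (t x y : A) :
    L.br t * L.anti x y - L.anti x y * L.br t =
      L.anti (L.br t x) y + L.anti x (L.br t y) := by
  have h1 := L.br_mul_tr_sub t x y
  have h2 := L.br_mul_tr_sub t y x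
  rw [anti_apply, anti_apply, anti_apply, mul_add, add_mul]
  calc _ = (L.br t * L.tr x y - L.tr x y * L.br t) + (L.br t * L.tr y x - L.tr y x * L.br t) := by
        abel
    _ = _ := by rw [h1, h2]; abel

/-- The fifth defining identity, read as a commutation rule for the operators `T(x, y, ·)`. -/
theorem tr_commutator (L : LieJordan F A) (v t x y : A) :
    L.tr v t * L.tr x y - L.tr x y * L.tr v t =
      L.tr (L.tr v t x) y - L.tr x (L.tr t v y) := by
  ext z
  have h := L.tr_tr x y z t v
  rw [L.tr_symm (L.tr x y z) t v, L.tr_symm x t v, L.tr_symm z t v, L.tr_symm y v t] at h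
  simp [h]

theorem br_br_end (L : LieJordan F A) (x y : A) : L.br (L.br x y) = L.tr x y - L.tr y x := by
  ext z; exact L.br_br x y z

theorem jacobi_end (L : LieJordan F A) (x y : A) :
    L.br (L.br x y) = L.br x * L.br y - L.br y * L.br x := by
  ext z
  have h1 := L.br_br x y z
  have h2 := L.br_br y z x
  have h3 := L.br_br x z y
  rw [L.br_skew (L.br y z)] at h2
  rw [L.br_skew (L.br x z)] at h3
  rw [neg_eq_iff_eq_neg] at h2 h3
  simp only [LinearMap.sub_apply, Module.End.mul_apply]
  rw [h1, h2, h3, L.tr_symm y z x, L.tr_symm z y x, L.tr_symm z x y]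
  abel

theorem br_self (L : LieJordan F A) (hF : (2 : F) ≠ 0) (x : A) : L.br x x = 0 := by
  have h := L.br_skew x x
  rw [eq_neg_iff_add_eq_zero, ← two_smul F] at h
  exact (smul_eq_zero.1 h).resolve_left hF

/-- The operator form of `a ∘ (h ∘ b) - b ∘ (h ∘ a) = [[a, b], h]` for `h = c ∘ d`. -/
theorem anti_anti_sub (L : LieJordan F A) (a b c d : A) :
    L.anti a (L.anti c d b) - L.anti b (L.anti c d a) =
      L.br (L.br a b) * L.anti c d - L.anti c d * L.br (L.br a b) := by
  have h1 := L.tr_commutator c d b a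
  have h2 := L.tr_commutator c d a b
  have h3 := L.tr_commutator d c b a
  have h4 := L.tr_commutator d c a b
  rw [br_br_end]
  simp only [anti_apply, LinearMap.add_apply, map_add]
  have : (L.tr a b - L.tr b a) * (L.tr c d + L.tr d c) -
      (L.tr c d + L.tr d c) * (L.tr a b - L.tr b a) =
      (L.tr c d * L.tr b a - L.tr b a * L.tr c d) - (L.tr c d * L.tr a b - L.tr a b * L.tr c d)
      + (L.tr d c * L.tr b a - L.tr b a * L.tr d c)
      - (L.tr d c * L.tr a b - L.tr a b * L.tr d c) := by noncomm_ring
  rw [this, h1, h2, h3, h4]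
  abel

/-- The operator form of `c ∘ (axa) + x ∘ (aca) = a ∘ (xac + cax)`. -/
theorem two_anti_tr (L : LieJordan F A) (a c x : A) :
    L.anti a (L.tr x a c) + L.anti a (L.tr x a c) =
      L.anti (L.tr a c a) x + L.anti c (L.tr a x a) := by
  have h1 := L.tr_commutator c a x a
  have h2 := L.tr_commutator x a c a
  have h3 := L.tr_commutator a c a x
  have h4 := L.tr_commutator a x a c
  rw [L.tr_symm c a x] at h1
  rw [L.tr_symm c a x] at h3
  simp only [anti_apply]
  rw [← sub_eq_zero]
  have e1 : L.tr (L.tr x a c) a - L.tr x (L.tr a c a) + (L.tr (L.tr x a c) a - L.tr c (L.tr a x a))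
      = 0 := by rw [← h1, ← h2]; abel
  have e2 : L.tr (L.tr a c a) x - L.tr a (L.tr x a c) + (L.tr (L.tr a x a) c - L.tr a (L.tr x a c))
      = 0 := by rw [← L.tr_symm c a x, L.tr_symm c a x, ← h3, ← h4]; abel
  calc _ = _ - _ := by rfl
    _ = (L.tr (L.tr x a c) a - L.tr x (L.tr a c a) + (L.tr (L.tr x a c) a - L.tr c (L.tr a x a)))
      - (L.tr (L.tr a c a) x - L.tr a (L.tr x a c) + (L.tr (L.tr a x a) c - L.tr a (L.tr x a c))) :=
        by abel
    _ = 0 := by rw [e1, e2, sub_zero]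

/-! ### Left multiplication on the envelope -/

/-- The part of left multiplication by `a` on `A × End A` that preserves both summands: commutation
with `a`. Left multiplication itself is `(evenPart a + oddPart a) / 2`. -/
def evenPart (L : LieJordan F A) (a : A) :
    Module.End F (A × Module.End F A) where
  toFun m := (L.br a m.1, L.br a * m.2 - m.2 * L.br a)
  map_add' m m' := by ext <;> simp; abel
  map_smul' c m := by ext <;> simp [smul_sub]

/-- The part of left multiplication by `a` on `A × End A` that exchanges the summands:
anticommutation with `a`. -/
def oddPart (L : LieJordan F A) (a : A) :
    Module.End F (A × Module.End F A) where
  toFun m := (m.2 a, L.anti a m.1)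
  map_add' m m' := by ext <;> simp
  map_smul' c m := by ext <;> simp

@[simp] theorem evenPart_apply (L : LieJordan F A) (a : A) (m : A × Module.End F A) :
    L.evenPart a m = (L.br a m.1, L.br a * m.2 - m.2 * L.br a) := rfl

@[simp] theorem oddPart_apply (L : LieJordan F A) (a : A) (m : A × Module.End F A) :
    L.oddPart a m = (m.2 a, L.anti a m.1) := rfl

/-- Left multiplication by `a` on `A × End A`: half the sum of commutation and anticommutation. -/
noncomputable def leftMul (L : LieJordan F A) : A →ₗ[F] Module.End F (A × Module.End F A) where
  toFun a := (2 : F)⁻¹ • (L.evenPart a + L.oddPart a)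
  map_add' a b := by
    rw [← smul_add]
    congr 1
    refine LinearMap.ext fun m => ?_
    ext <;> simp <;> abel
  map_smul' c a := by
    rw [RingHom.id_apply, smul_comm]
    congr 1
    refine LinearMap.ext fun m => ?_
    ext <;> simp [smul_sub]

/-- The space `A × antiSpan` on which the envelope acts from the left. -/
def envelope (L : LieJordan F A) : Submodule F (A × Module.End F A) :=
  (⊤ : Submodule F A).prod L.antiSpan

theorem br_mul_sub_mem (L : LieJordan F A) (a : A) {h : Module.End F A} (hh : h ∈ L.antiSpan) :
    L.br a * h - h * L.br a ∈ L.antiSpan := by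
  induction hh using Submodule.span_induction with
  | mem x hx =>
    obtain ⟨c, d, rfl⟩ := hx
    rw [br_mul_anti_sub]
    exact add_mem (L.anti_mem _ _) (L.anti_mem _ _)
  | zero => simp
  | add x y _ _ hx hy =>
    convert add_mem hx hy using 1
    noncomm_ring
  | smul c x _ hx =>
    convert Submodule.smul_mem _ c hx using 1
    simp [smul_sub]

theorem evenPart_mem (L : LieJordan F A) (a : A) {m : A × Module.End F A} (hm : m ∈ L.envelope) :
    L.evenPart a m ∈ L.envelope :=
  ⟨trivial, L.br_mul_sub_mem a hm.2⟩

theorem oddPart_mem (L : LieJordan F A) (a : A) {m : A × Module.End F A} :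
    L.oddPart a m ∈ L.envelope :=
  ⟨trivial, L.anti_mem _ _⟩

theorem leftMul_mem (L : LieJordan F A) (a : A) {m : A × Module.End F A} (hm : m ∈ L.envelope) :
    L.leftMul a m ∈ L.envelope :=
  Submodule.smul_mem _ _ (add_mem (L.evenPart_mem a hm) (L.oddPart_mem a))

theorem evenPart_br (L : LieJordan F A) (a b : A) :
    L.evenPart (L.br a b) = L.evenPart a * L.evenPart b - L.evenPart b * L.evenPart a := by
  refine LinearMap.ext fun m => Prod.ext ?_ ?_
  · simp [jacobi_end]
  · simp only [evenPart_apply, LinearMap.sub_apply, Module.End.mul_apply, jacobi_end, Prod.snd_sub]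
    noncomm_ring

theorem oddPart_br (L : LieJordan F A) (a b : A) :
    L.oddPart (L.br a b) = L.evenPart a * L.oddPart b - L.oddPart b * L.evenPart a := by
  refine LinearMap.ext fun m => Prod.ext ?_ ?_
  · simp
  · simp [br_mul_anti_sub]

/-- On the envelope the odd parts of left multiplications commute to even parts. -/
theorem oddPart_commutator (L : LieJordan F A) (a b : A) {m : A × Module.End F A}
    (hm : m ∈ L.envelope) :
    L.evenPart (L.br a b) m = L.oddPart a (L.oddPart b m) - L.oddPart b (L.oddPart a m) := by
  obtain ⟨x, h⟩ := m
  refine Prod.ext ?_ ?_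
  · simp only [evenPart_apply, oddPart_apply, Prod.fst_sub, anti_apply_apply]
    rw [br_br, L.tr_symm b x a, L.tr_symm x b a, L.tr_symm x a b]
    abel
  · have hh : h ∈ L.antiSpan := hm.2
    simp only [evenPart_apply, oddPart_apply, Prod.snd_sub]
    clear hm
    induction hh using Submodule.span_induction with
    | mem x hx =>
      obtain ⟨c, d, rfl⟩ := hx
      exact (L.anti_anti_sub a b c d).symm
    | zero => simp
    | add x y _ _ hx hy =>
      simp only [LinearMap.add_apply, map_add, mul_add, add_mul]
      rw [add_sub_add_comm, hx, hy]
      abel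
    | smul c x _ hx =>
      simp only [LinearMap.smul_apply, map_smul, mul_smul_comm, smul_mul_assoc, ← smul_sub, hx]

theorem leftMul_apply (L : LieJordan F A) (a : A) (m : A × Module.End F A) :
    L.leftMul a m = (2 : F)⁻¹ • (L.evenPart a m + L.oddPart a m) := rfl

theorem leftMul_br (L : LieJordan F A) (hF : (2 : F) ≠ 0) (a b : A) {m : A × Module.End F A}
    (hm : m ∈ L.envelope) :
    L.leftMul (L.br a b) m = L.leftMul a (L.leftMul b m) - L.leftMul b (L.leftMul a m) := by
  have h1 : L.evenPart (L.br a b) m =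
      L.evenPart a (L.evenPart b m) - L.evenPart b (L.evenPart a m) := by
    rw [evenPart_br]; rfl
  have h2 : L.oddPart (L.br a b) m =
      L.evenPart a (L.oddPart b m) - L.oddPart b (L.evenPart a m) := by
    rw [oddPart_br]; rfl
  have h3 := L.oddPart_commutator a b hm
  have h4 : L.oddPart (L.br a b) m =
      L.oddPart a (L.evenPart b m) - L.evenPart b (L.oddPart a m) := by
    have : L.oddPart (L.br a b) = -L.oddPart (L.br b a) := by
      rw [L.br_skew a b]; ext <;> simp
    rw [this, oddPart_br]
    simp only [LinearMap.neg_apply, LinearMap.sub_apply, Module.End.mul_apply]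
    abel
  have h5 : (2 : F) • (L.evenPart (L.br a b) m + L.oddPart (L.br a b) m) =
      L.evenPart a (L.evenPart b m) - L.evenPart b (L.evenPart a m) +
      (L.evenPart a (L.oddPart b m) - L.oddPart b (L.evenPart a m)) +
      (L.oddPart a (L.oddPart b m) - L.oddPart b (L.oddPart a m)) +
      (L.oddPart a (L.evenPart b m) - L.evenPart b (L.oddPart a m)) := by
    rw [← h1, ← h2, ← h3, ← h4, two_smul]; abel
  have h6 := congrArg (fun z => ((2 : F)⁻¹ * (2 : F)⁻¹) • z) h5
  rw [← mul_smul, mul_assoc, inv_mul_cancel₀ hF, mul_one] at h6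
  simp only [leftMul_apply, map_smul, map_add, h6]
  module

/-- The odd part of left multiplication acts as a derivation on left multiplications. -/
theorem oddPart_leftMul (L : LieJordan F A) (y a : A) {m : A × Module.End F A}
    (hm : m ∈ L.envelope) :
    L.leftMul a (L.oddPart y m) = L.oddPart y (L.leftMul a m) - L.leftMul (L.br y a) m := by
  have h2 : L.oddPart (L.br y a) m =
      L.oddPart y (L.evenPart a m) - L.evenPart a (L.oddPart y m) := by
    have : L.oddPart (L.br y a) = -L.oddPart (L.br a y) := by
      rw [L.br_skew y a]; ext <;> simp
    rw [this, oddPart_br]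
    simp only [LinearMap.neg_apply, LinearMap.sub_apply, Module.End.mul_apply]
    abel
  simp only [leftMul_apply, map_smul, map_add, h2, L.oddPart_commutator y a hm, ← smul_sub]
  congr 1
  abel

/-! ### The triple product on the summand `A` -/

/-- The operator form of `c ∘ (aax + xaa) - x ∘ (aac + caa) = [[c, x], a] ∘ a`. -/
theorem anti_tr_sub (L : LieJordan F A) (hF : (2 : F) ≠ 0) (a c x : A) :
    L.anti c (L.tr a a x) - L.anti x (L.tr a a c) =
      L.anti a (L.tr c x a) - L.anti a (L.tr x c a) := by
  have h := L.anti_anti_sub c x a a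
  rw [br_mul_anti_sub, L.br_br, anti_apply_apply, anti_apply_apply,
    L.anti_comm (L.tr c x a - L.tr x c a) a] at h
  simp only [map_add, map_sub] at h
  have h2 : (2 : F) • (L.anti c (L.tr a a x) - L.anti x (L.tr a a c)) =
      (2 : F) • (L.anti a (L.tr c x a) - L.anti a (L.tr x c a)) := by
    rw [two_smul, two_smul, ← h]; abel
  exact (smul_right_injective _ hF) h2

/-- The square of twice left multiplication by `a`. -/
theorem doubled_leftMul_sq (L : LieJordan F A) (hF : (2 : F) ≠ 0) (a y : A) (k : Module.End F A) :
    (L.evenPart a + L.oddPart a) ((L.evenPart a + L.oddPart a) (y, k)) =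
      (2 • L.tr a a y + 2 • L.br a (k a),
        2 • L.anti a (L.br a y) + L.anti a (k a) +
          (L.br a * (L.br a * k - k * L.br a) - (L.br a * k - k * L.br a) * L.br a)) := by
  refine Prod.ext ?_ ?_
  · have h1 := L.br_br a y a
    rw [L.br_skew (L.br a y) a, neg_eq_iff_eq_neg] at h1
    simp only [evenPart_apply, oddPart_apply, LinearMap.add_apply, Prod.fst_add,
      Module.End.mul_apply, LinearMap.sub_apply, map_add, anti_apply_apply, L.br_self hF a,
      map_zero]
    rw [h1, L.tr_symm y a a]
    abel
  · have h1 := L.br_mul_anti_sub a a y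
    rw [L.br_self hF a, map_zero, LinearMap.zero_apply, zero_add] at h1
    simp only [evenPart_apply, oddPart_apply, LinearMap.add_apply, Prod.snd_add,
      map_add]
    rw [h1]
    abel

/-- The identity `a²c + ca² = T(a, a, c)` for left multiplications, on elements of `A`. -/
theorem doubled_leftMul_tr (L : LieJordan F A) (hF : (2 : F) ≠ 0) (a c x : A) :
    (L.evenPart a + L.oddPart a) ((L.evenPart a + L.oddPart a)
        ((L.evenPart c + L.oddPart c) (x, 0))) +
      (L.evenPart c + L.oddPart c) ((L.evenPart a + L.oddPart a)
        ((L.evenPart a + L.oddPart a) (x, 0))) =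
      4 • (L.evenPart (L.tr a a c) + L.oddPart (L.tr a a c)) (x, 0) := by
  have hc : (L.evenPart c + L.oddPart c) (x, 0) = (L.br c x, L.anti c x) := by
    ext <;> simp
  rw [hc, doubled_leftMul_sq L hF, doubled_leftMul_sq L hF]
  refine Prod.ext ?_ ?_
  · have h2 := L.br_tr a c x a
    have h3 := L.br_tr a x c a
    have h4 := L.br_tr c a a x
    have h5 : L.br (L.tr a a c) x = -L.br x (L.tr a a c) := L.br_skew _ _
    have h6 := L.br_tr x a a c
    have h7 := L.br_br a x (L.br a c)
    have h8 := L.br_br a c (L.br a x)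
    have h9 : L.br (L.br a c) (L.br a x) = - L.br (L.br a x) (L.br a c) := L.br_skew _ _
    rw [L.br_self hF a, map_zero, L.tr_symm c (L.br a x) a] at h2
    rw [L.br_self hF a, map_zero, L.tr_symm x (L.br a c) a] at h3
    rw [L.br_skew x a, L.br_skew x c] at h6
    rw [L.br_skew c a] at h4
    simp only [map_neg, LinearMap.neg_apply] at h4 h6
    rw [L.tr_symm a x, L.tr_symm x a] at h7
    rw [L.tr_symm a c, L.tr_symm c a] at h8
    simp only [evenPart_apply, oddPart_apply, LinearMap.add_apply, Prod.fst_add,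
      map_add, anti_apply_apply, LinearMap.zero_apply, map_zero,
      Prod.smul_fst, h5, add_zero, two_smul, smul_add, mul_zero, zero_mul, sub_zero]
    -- after expanding brackets of triple products, what remains is a multiple of `[u, w] + [w, u]`
    -- for `u = [a, c]` and `w = [a, x]`
    linear_combination (norm := module) (2 : F) • h2 + (2 : F) • h3 + (2 : F) • h4 + (4 : F) • h6
      + (2 : F) • h9 - (2 : F) • h7 - (2 : F) • h8
  · have h1 := L.anti_tr_sub hF a c x
    have h2 := L.two_anti_tr a c x
    have h3 := L.br_mul_anti_sub a c x
    have h4 := L.br_mul_anti_sub a (L.br a c) x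
    have h5 := L.br_mul_anti_sub a c (L.br a x)
    have h6 := L.br_mul_anti_sub c a (L.br a x)
    have b1 : ∀ y z, L.br a (L.br y z) = L.tr z y a - L.tr y z a := fun y z => by
      rw [L.br_skew, L.br_br, neg_sub]
    have b2 : L.br c (L.br a x) = L.tr x a c - L.tr a x c := by
      rw [L.br_skew, L.br_br, neg_sub]
    rw [b1] at h4 h5
    rw [b2, L.br_skew c a] at h6
    simp only [evenPart_apply, oddPart_apply, LinearMap.add_apply, Prod.snd_add,
      map_add, anti_apply_apply, LinearMap.zero_apply, map_zero, mul_zero, zero_mul, sub_zero,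
      Prod.smul_snd, add_zero, two_smul, smul_add, h3, mul_add, add_mul, b1]
    simp only [map_sub, map_neg, LinearMap.sub_apply, LinearMap.neg_apply] at h4 h5 h6 ⊢
    rw [L.tr_symm a x c, L.anti_comm (L.tr a a c)] at *
    rw [L.tr_symm c a a, L.anti_comm (L.tr a a c)] at *
    rw [L.tr_symm x a a] at *
    linear_combination (norm := module) (1 : F) • h4 + (1 : F) • h5 + (2 : F) • h6 + (3 : F) • h1
      + (1 : F) • h2

/-! ### A faithful specialization -/

/-- The envelope as a type of its own, with its module structure. -/
def Envelope (L : LieJordan F A) : Type _ := ↥L.envelope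

instance (L : LieJordan F A) : AddCommGroup L.Envelope := inferInstanceAs (AddCommGroup L.envelope)

instance (L : LieJordan F A) : Module F L.Envelope := inferInstanceAs (Module F L.envelope)

instance (L : LieJordan F A) [FiniteDimensional F A] : FiniteDimensional F L.Envelope :=
  inferInstanceAs (FiniteDimensional F L.envelope)

/-- Left multiplication by elements of `A` on the envelope. -/
noncomputable def envMul (L : LieJordan F A) : A →ₗ[F] Module.End F L.Envelope where
  toFun a := (L.leftMul a).restrict fun _ hm => L.leftMul_mem a hm
  map_add' a b := LinearMap.ext fun m => Subtype.ext <|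
    LinearMap.congr_fun (map_add L.leftMul a b) m.1
  map_smul' c a := LinearMap.ext fun m => Subtype.ext <|
    LinearMap.congr_fun (map_smul L.leftMul c a) m.1

/-- The odd part of left multiplication on the envelope. -/
def envOdd (L : LieJordan F A) (y : A) : Module.End F L.Envelope :=
  (L.oddPart y).restrict fun _ _ => L.oddPart_mem y

/-- The embedding of `A` as the first summand of the envelope. -/
def envIncl (L : LieJordan F A) (x : A) : L.Envelope := ⟨(x, 0), trivial, zero_mem _⟩

/-- The embedding of `antiSpan` as the second summand of the envelope. -/
def envEven (L : LieJordan F A) : L.antiSpan →ₗ[F] L.Envelope where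
  toFun h := ⟨(0, h), trivial, h.2⟩
  map_add' _ _ := Subtype.ext (Prod.ext (add_zero 0).symm rfl)
  map_smul' r _ := Subtype.ext (Prod.ext (smul_zero r).symm rfl)

theorem exists_envIncl_add_envEven (L : LieJordan F A) (m : L.Envelope) :
    ∃ x h, m = L.envIncl x + L.envEven h :=
  ⟨m.1.1, ⟨m.1.2, m.2.2⟩,
    Subtype.ext (Prod.ext (add_zero m.1.1).symm (zero_add m.1.2).symm)⟩

theorem envMul_br (L : LieJordan F A) (hF : (2 : F) ≠ 0) (a b : A) :
    L.envMul (L.br a b) = L.envMul a * L.envMul b - L.envMul b * L.envMul a := by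
  refine LinearMap.ext fun m => Subtype.ext ?_
  exact L.leftMul_br hF a b m.2

theorem envOdd_mul_envMul (L : LieJordan F A) (y a : A) :
    L.envOdd y * L.envMul a = L.envMul a * L.envOdd y + L.envMul (L.br y a) := by
  refine LinearMap.ext fun m => Subtype.ext ?_
  exact (sub_eq_iff_eq_add.1 (L.oddPart_leftMul y a m.2).symm)

/-- The obstruction to `envMul` respecting the triple product. -/
noncomputable def trDefect (L : LieJordan F A) (a b c : A) : Module.End F L.Envelope :=
  L.envMul a * L.envMul b * L.envMul c + L.envMul c * L.envMul b * L.envMul a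
    - L.envMul (L.tr a b c)

theorem trDefect_self_incl (L : LieJordan F A) (hF : (2 : F) ≠ 0) (a c x : A) :
    L.trDefect a a c (L.envIncl x) = 0 := by
  have h := L.doubled_leftMul_tr hF a c x
  have e : ∀ a : A, L.evenPart a + L.oddPart a = (2 : F) • L.leftMul a := fun a => by
    refine LinearMap.ext fun m => ?_
    rw [LinearMap.smul_apply, leftMul_apply, smul_inv_smul₀ hF]
    rfl
  simp only [e, LinearMap.smul_apply, map_smul] at h
  have h8 : (8 : F) ≠ 0 := by
    have : (8 : F) = 2 * 2 * 2 := by norm_num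
    rw [this]
    exact mul_ne_zero (mul_ne_zero hF hF) hF
  have h' : (8 : F) • (L.leftMul a (L.leftMul a (L.leftMul c (x, 0))) +
      L.leftMul c (L.leftMul a (L.leftMul a (x, 0))) - L.leftMul (L.tr a a c) (x, 0)) = 0 := by
    rw [smul_sub, sub_eq_zero]
    calc _ = _ := by module
      _ = _ := h
      _ = _ := by module
  exact Subtype.ext ((smul_eq_zero.1 h').resolve_left h8)

theorem trDefect_incl (L : LieJordan F A) (hF : (2 : F) ≠ 0) (a b c x : A) :
    L.trDefect a b c (L.envIncl x) = 0 := by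
  have hab := L.trDefect_self_incl hF (a + b) c x
  have ha := L.trDefect_self_incl hF a c x
  have hb := L.trDefect_self_incl hF b c x
  -- polarization controls the part symmetric in `a` and `b`, the bracket the skew part
  have key : L.trDefect a b c + L.trDefect a b c =
      L.trDefect (a + b) (a + b) c - L.trDefect a a c - L.trDefect b b c := by
    have h1 := L.envMul_br hF (L.br a b) c
    rw [L.envMul_br hF a b, L.br_br, map_sub] at h1
    simp only [trDefect, map_add, LinearMap.add_apply]
    rw [sub_eq_iff_eq_add] at h1
    rw [h1]
    noncomm_ring
  have h2 : (2 : F) • L.trDefect a b c (L.envIncl x) = 0 := by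
    rw [two_smul, ← LinearMap.add_apply, key]
    simp [hab, ha, hb]
  exact (smul_eq_zero.1 h2).resolve_left hF

/-- Anticommutation with `y` acts on the defect as a derivation. -/
theorem envOdd_mul_trDefect (L : LieJordan F A) (y a b c : A) :
    L.envOdd y * L.trDefect a b c = L.trDefect a b c * L.envOdd y +
      (L.trDefect (L.br y a) b c + L.trDefect a (L.br y b) c + L.trDefect a b (L.br y c)) := by
  have h : ∀ p q r : A, L.envOdd y * (L.envMul p * L.envMul q * L.envMul r) =
      L.envMul p * L.envMul q * L.envMul r * L.envOdd y +
        (L.envMul (L.br y p) * L.envMul q * L.envMul r +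
        L.envMul p * L.envMul (L.br y q) * L.envMul r +
        L.envMul p * L.envMul q * L.envMul (L.br y r)) := fun p q r => by
    rw [← mul_assoc, ← mul_assoc, envOdd_mul_envMul, add_mul, add_mul, mul_assoc (L.envMul p),
      envOdd_mul_envMul, mul_add, add_mul, mul_assoc (L.envMul p), mul_assoc (L.envMul q),
      envOdd_mul_envMul]
    noncomm_ring
  simp only [trDefect]
  rw [mul_sub, mul_add, h, h, envOdd_mul_envMul, L.br_tr]
  simp only [map_add]
  noncomm_ring

theorem trDefect_eq_zero (L : LieJordan F A) (hF : (2 : F) ≠ 0) (a b c : A) :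
    L.trDefect a b c = 0 := by
  refine LinearMap.ext fun m => ?_
  obtain ⟨x, ⟨h, hh⟩, rfl⟩ := L.exists_envIncl_add_envEven m
  rw [map_add, L.trDefect_incl hF, zero_add, LinearMap.zero_apply]
  clear x
  induction hh using Submodule.span_induction with
  | mem k hk =>
    obtain ⟨y, z, rfl⟩ := hk
    -- `anti y z` is the image of `z` under the odd part of left multiplication by `y`
    have e : L.envEven ⟨L.anti y z, L.anti_mem y z⟩ = L.envOdd y (L.envIncl z) :=
      Subtype.ext (Prod.ext rfl rfl)
    have h1 := LinearMap.congr_fun (L.envOdd_mul_trDefect y a b c) (L.envIncl z)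
    simp only [Module.End.mul_apply, LinearMap.add_apply, L.trDefect_incl hF, map_zero,
      add_zero] at h1
    rw [e, ← h1]
  | zero => exact (congrArg _ (map_zero L.envEven)).trans (map_zero _)
  | add k l hk hl h1 h2 =>
    have e : L.envEven ⟨k + l, add_mem hk hl⟩ = L.envEven ⟨k, hk⟩ + L.envEven ⟨l, hl⟩ :=
      map_add L.envEven ⟨k, hk⟩ ⟨l, hl⟩
    rw [e, map_add, h1, h2, add_zero]
  | smul r k hk h1 =>
    have e : L.envEven ⟨r • k, Submodule.smul_mem _ r hk⟩ = r • L.envEven ⟨k, hk⟩ :=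
      map_smul L.envEven r ⟨k, hk⟩
    rw [e, map_smul, h1, smul_zero]

/-- Every Lie-Jordan algebra acts on its envelope by left multiplications. -/
theorem isSpecialization_envMul (L : LieJordan F A) (hF : (2 : F) ≠ 0) :
    L.IsSpecialization (R := Module.End F L.Envelope) L.envMul where
  map_br := L.envMul_br hF
  map_tr a b c := (sub_eq_zero.1 (L.trDefect_eq_zero hF a b c)).symm

/-- An element that acts by zero on the envelope annihilates the algebra. -/
theorem annihilates_of_envMul_eq_zero (L : LieJordan F A) (hF : (2 : F) ≠ 0) {a : A}
    (ha : L.envMul a = 0) :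
    (∀ x, L.br a x = 0) ∧ (∀ x y, L.tr a x y = 0) ∧ (∀ x y, L.tr x a y = 0) := by
  have h0 : ∀ x, L.br a x = 0 ∧ L.anti a x = 0 := fun x => by
    have h := congrArg Subtype.val (LinearMap.congr_fun ha (L.envIncl x))
    change (2 : F)⁻¹ • (L.evenPart a (x, 0) + L.oddPart a (x, 0)) = 0 at h
    have h := (smul_eq_zero.1 h).resolve_left (inv_ne_zero hF)
    simpa [Prod.ext_iff] using h
  have h1 : ∀ x y, L.tr a x y = 0 := fun x y => by
    have h2 := LinearMap.congr_fun (h0 x).2 y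
    have h3 := L.br_br a x y
    rw [(h0 x).1, map_zero, LinearMap.zero_apply, eq_comm, sub_eq_zero] at h3
    rw [anti_apply_apply, ← h3, ← two_smul F] at h2
    exact (smul_eq_zero.1 h2).resolve_left hF
  refine ⟨fun x => (h0 x).1, h1, fun x y => ?_⟩
  have h3 := L.br_br a x y
  rw [(h0 x).1, map_zero, LinearMap.zero_apply, h1, zero_sub] at h3
  exact neg_eq_zero.1 h3.symm

/-- The kernel of a specialization is an ideal. -/
theorem IsSpecialization.isIdeal_ker {L : LieJordan F A} {R : Type*} [Ring R] [Algebra F R]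
    {ρ : A →ₗ[F] R} (hρ : L.IsSpecialization ρ) : L.IsIdeal (LinearMap.ker ρ) where
  br_left x y hx := by simp_all [hρ.map_br]
  br_right x y hx := by simp_all [hρ.map_br]
  tr_left x y z hx := by simp_all [hρ.map_tr]
  tr_mid x y z hx := by simp_all [hρ.map_tr]
  tr_right x y z hx := by simp_all [hρ.map_tr]

theorem IsSimple.envMul_injective {L : LieJordan F A} (hL : L.IsSimple) (hF : (2 : F) ≠ 0) :
    Function.Injective L.envMul := by
  rw [← LinearMap.ker_eq_bot]
  refine (hL.eq_bot_or_eq_top _ (L.isSpecialization_envMul hF).isIdeal_ker).resolve_right ?_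
  intro h
  have h0 : ∀ a, L.envMul a = 0 := fun a => LinearMap.mem_ker.1 (h ▸ Submodule.mem_top)
  rcases hL.nonzero with ⟨x, y, hxy⟩ | ⟨x, y, z, hxyz⟩
  · exact hxy ((L.annihilates_of_envMul_eq_zero hF (h0 x)).1 y)
  · exact hxyz ((L.annihilates_of_envMul_eq_zero hF (h0 x)).2.1 y z)

/-! ### Irreducible representations -/

theorem IsSpecialization.comp_algHom {L : LieJordan F A} {R S : Type*} [Ring R] [Algebra F R]
    [Ring S] [Algebra F S] {ρ : A →ₗ[F] R} (hρ : L.IsSpecialization ρ) (φ : R →ₐ[F] S) :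
    L.IsSpecialization (φ.toLinearMap ∘ₗ ρ) where
  map_br x y := by simp [hρ.map_br]
  map_tr x y z := by simp [hρ.map_tr]

theorem IsSimple.injective_or_eq_zero {L : LieJordan F A} (hL : L.IsSimple) {R : Type*} [Ring R]
    [Algebra F R] {ρ : A →ₗ[F] R} (hρ : L.IsSpecialization ρ) :
    Function.Injective ρ ∨ ∀ a, ρ a = 0 := by
  rw [← LinearMap.ker_eq_bot]
  refine (hL.eq_bot_or_eq_top _ hρ.isIdeal_ker).imp_right fun h a => ?_
  exact LinearMap.mem_ker.1 (h ▸ Submodule.mem_top)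

theorem IsSpecialization.restrict {L : LieJordan F A} {V : Type*} [AddCommGroup V] [Module F V]
    {ρ : A →ₗ[F] Module.End F V} (hρ : L.IsSpecialization ρ) {W : Submodule F V}
    (hW : ∀ a, ∀ w ∈ W, ρ a w ∈ W) :
    ∃ σ : A →ₗ[F] Module.End F W, L.IsSpecialization σ ∧ ∀ a w, (σ a w : V) = ρ a w :=
  ⟨{ toFun := fun a => (ρ a).restrict (hW a)
     map_add' := fun a b => by ext; simp
     map_smul' := fun c a => by ext; simp },
    ⟨fun x y => by ext; simp [hρ.map_br], fun x y z => by ext; simp [hρ.map_tr]⟩,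
    fun _ _ => rfl⟩

theorem IsSpecialization.quotient {L : LieJordan F A} {V : Type*} [AddCommGroup V] [Module F V]
    {ρ : A →ₗ[F] Module.End F V} (hρ : L.IsSpecialization ρ) {W : Submodule F V}
    (hW : ∀ a, ∀ w ∈ W, ρ a w ∈ W) :
    ∃ σ : A →ₗ[F] Module.End F (V ⧸ W), L.IsSpecialization σ ∧
      ∀ a v, σ a (W.mkQ v) = W.mkQ (ρ a v) :=
  ⟨{ toFun := fun a => W.mapQ W (ρ a) (hW a)
     map_add' := fun a b => by ext; simp
     map_smul' := fun c a => by ext; simp },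
    ⟨fun x y => by ext; simp [hρ.map_br], fun x y z => by ext; simp [hρ.map_tr]⟩,
    fun _ _ => rfl⟩

/-- There is a faithful representation on `Fⁿ`. -/
def HasFaithfulRep (L : LieJordan F A) (n : ℕ) : Prop :=
  ∃ ρ : A →ₗ[F] Module.End F (Fin n → F), L.IsSpecialization ρ ∧ Function.Injective ρ

theorem IsSpecialization.hasFaithfulRep {L : LieJordan F A} {V : Type*} [AddCommGroup V]
    [Module F V] [FiniteDimensional F V]
    {ρ : A →ₗ[F] Module.End F V} (hρ : L.IsSpecialization ρ) (hinj : Function.Injective ρ) :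
    L.HasFaithfulRep (Module.finrank F V) := by
  let e : Module.End F V ≃ₐ[F] Module.End F (Fin (Module.finrank F V) → F) :=
    LinearEquiv.conjAlgEquiv F (Module.finBasis F V).equivFun
  exact ⟨_, hρ.comp_algHom e.toAlgHom, e.injective.comp hinj⟩

/-- A faithful representation of least dimension is irreducible: if both a proper invariant subspace
and its quotient are killed, then all products of two operators vanish. -/
theorem IsSimple.exists_irreducible {L : LieJordan F A} (hL : L.IsSimple) {n₀ : ℕ}
    (h₀ : L.HasFaithfulRep n₀) :
    ∃ (n : ℕ) (ρ : A →ₗ[F] Module.End F (Fin n → F)), L.IsSpecialization ρ ∧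
      Function.Injective ρ ∧
      ∀ W : Submodule F (Fin n → F), (∀ a, ∀ w ∈ W, ρ a w ∈ W) → W = ⊥ ∨ W = ⊤ := by
  classical
  have hex : ∃ n, L.HasFaithfulRep n := ⟨n₀, h₀⟩
  obtain ⟨ρ, hρ, hinj⟩ := Nat.find_spec hex
  refine ⟨Nat.find hex, ρ, hρ, hinj, fun W hW => ?_⟩
  by_contra! hne
  obtain ⟨σ, hσ, hσρ⟩ := hρ.restrict hW
  obtain ⟨τ, hτ, hτρ⟩ := hρ.quotient hW
  have hσ0 : ∀ a, σ a = 0 := (hL.injective_or_eq_zero hσ).resolve_left fun h =>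
    Nat.find_min hex (by simpa using Submodule.finrank_lt hne.2) (hσ.hasFaithfulRep h)
  have hτ0 : ∀ a, τ a = 0 := (hL.injective_or_eq_zero hτ).resolve_left fun h => by
    refine Nat.find_min hex ?_ (hτ.hasFaithfulRep h)
    have h1 := Submodule.finrank_quotient_add_finrank W
    have h2 := Submodule.one_le_finrank_iff.2 hne.1
    simp only [Module.finrank_fintype_fun_eq_card, Fintype.card_fin] at h1
    omega
  have hmul : ∀ a b, ρ a * ρ b = 0 := fun a b => LinearMap.ext fun v => by
    have h1 : ρ b v ∈ W := by
      have := hτρ b v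
      rw [hτ0, LinearMap.zero_apply, eq_comm] at this
      simpa using this
    have h2 := hσρ a ⟨_, h1⟩
    rw [hσ0] at h2
    exact h2.symm
  rcases hL.nonzero with ⟨x, y, h⟩ | ⟨x, y, z, h⟩
  · exact h (hinj (by rw [hρ.map_br, hmul, hmul, sub_zero, map_zero]))
  · exact h (hinj (by rw [hρ.map_tr, hmul, hmul, zero_mul, zero_mul, add_zero, map_zero]))

/-- **Burnside's theorem**: over an algebraically closed field, a set of operators without proper
invariant subspaces generates the full endomorphism algebra. -/
theorem _root_.Algebra.adjoin_eq_top_of_irreducible [IsAlgClosed F] {V : Type*} [AddCommGroup V]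
    [Module F V] [FiniteDimensional F V] [Nontrivial V] (S : Set (Module.End F V))
    (hS : ∀ W : Submodule F V, (∀ f ∈ S, ∀ w ∈ W, f w ∈ W) → W = ⊥ ∨ W = ⊤) :
    Algebra.adjoin F S = ⊤ := by
  set U := Algebra.adjoin F S with hU
  have : IsSimpleModule U V := by
    refine { eq_bot_or_eq_top := fun N => ?_ }
    refine (hS (N.restrictScalars F) fun f hf w hw =>
      N.smul_mem (⟨f, Algebra.subset_adjoin hf⟩ : U) hw).imp ?_ ?_
    · simp
    · simp
  rw [eq_top_iff]
  intro f _
  have hbij := IsSimpleModule.algebraMap_end_bijective_of_isAlgClosed (A := U) (V := V) F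
  let g : Module.End (Module.End U V) V :=
    { toFun := f
      map_add' := map_add f
      map_smul' := fun r v => by
        obtain ⟨c, rfl⟩ := hbij.2 r
        exact map_smul f c v }
  obtain ⟨s, hs⟩ := Module.Finite.fg_top (R := F) (M := V)
  obtain ⟨r, hr⟩ := jacobson_density g s
  have : f = r := LinearMap.ext_on hs fun v hv => hr v hv
  rw [this]
  exact r.2

/-- A finite-dimensional simple Lie-Jordan algebra generates a full matrix algebra in some faithful
specialization. -/
theorem IsSimple.exists_matrix_specialization [IsAlgClosed F] [FiniteDimensional F A]
    {L : LieJordan F A} (hL : L.IsSimple) (hF : (2 : F) ≠ 0) :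
    ∃ (n : ℕ) (ρ : A →ₗ[F] Matrix (Fin n) (Fin n) F), 1 ≤ n ∧ L.IsSpecialization ρ ∧
      Function.Injective ρ ∧ Algebra.adjoin F (Set.range ρ) = ⊤ := by
  obtain ⟨n, ρ, hρ, hinj, hirr⟩ := hL.exists_irreducible
    ((L.isSpecialization_envMul hF).hasFaithfulRep (hL.envMul_injective hF))
  have hn : n ≠ 0 := by
    rintro rfl
    have h : ∀ x y : A, x = y := fun x y => hinj (Subsingleton.elim _ _)
    rcases hL.nonzero with ⟨x, y, h'⟩ | ⟨x, y, z, h'⟩ <;> exact h' (h _ _)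
  have : Nonempty (Fin n) := ⟨⟨0, Nat.pos_of_ne_zero hn⟩⟩
  have htop : Algebra.adjoin F (Set.range ρ) = ⊤ :=
    Algebra.adjoin_eq_top_of_irreducible _ fun W hW =>
      hirr W fun a => hW _ ⟨a, rfl⟩
  let e : Module.End F (Fin n → F) ≃ₐ[F] Matrix (Fin n) (Fin n) F := LinearMap.toMatrixAlgEquiv'
  refine ⟨n, _, Nat.pos_of_ne_zero hn, hρ.comp_algHom e.toAlgHom, e.injective.comp hinj, ?_⟩
  have := congrArg (Subalgebra.map e.toAlgHom) htop
  rw [AlgHom.map_adjoin, ← Set.range_comp, Algebra.map_top] at this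
  rw [eq_top_iff, ← (AlgHom.range_eq_top e.toAlgHom).2 e.surjective]
  exact this.ge

/-! ### The symmetric part of the generated ring -/

section Symmetric

variable {R : Type*} [Ring R] [Algebra F R]

/-- The span of `1` and the anticommutators `ab + ba` of elements of `K`. -/
def symPart (K : Submodule F R) : Submodule F R :=
  Submodule.span F ({1} ∪ {s | ∃ a ∈ K, ∃ b ∈ K, a * b + b * a = s})

theorem one_mem_symPart (K : Submodule F R) : (1 : R) ∈ symPart K :=
  Submodule.subset_span (Or.inl rfl)

theorem anticomm_mem_symPart {K : Submodule F R} {a b : R} (ha : a ∈ K) (hb : b ∈ K) :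
    a * b + b * a ∈ symPart K :=
  Submodule.subset_span (Or.inr ⟨a, ha, b, hb, rfl⟩)

/-- A linear property of `x` that holds for `1` and for anticommutators holds on `symPart K`. -/
theorem symPart_le {K P : Submodule F R} (h1 : (1 : R) ∈ P)
    (h : ∀ a ∈ K, ∀ b ∈ K, a * b + b * a ∈ P) : symPart K ≤ P := by
  refine Submodule.span_le.2 ?_
  rintro _ (rfl | ⟨a, ha, b, hb, rfl⟩)
  · exact h1
  · exact h a ha b hb

/-- A subspace closed under `xy - yx` and `xyz + zyx`. -/
structure IsClosedLJ (K : Submodule F R) : Prop where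
  br_mem : ∀ a ∈ K, ∀ b ∈ K, a * b - b * a ∈ K
  tr_mem : ∀ a ∈ K, ∀ b ∈ K, ∀ c ∈ K, a * b * c + c * b * a ∈ K

theorem mul_mem_of_half (hF : (2 : F) ≠ 0) {P : Submodule F R} {x y : R}
    (h1 : x * y + y * x ∈ P) (h2 : x * y - y * x ∈ P) : x * y ∈ P := by
  refine (Submodule.smul_mem_iff _ hF).1 ?_
  convert add_mem h1 h2 using 1
  rw [two_smul]
  abel

namespace IsClosedLJ

variable {K : Submodule F R} (hK : IsClosedLJ K)

include hK

theorem anticomm_sym_mem {k s : R} (hk : k ∈ K) (hs : s ∈ symPart K) : k * s + s * k ∈ K := by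
  let P : Submodule F R := K.comap (LinearMap.mulLeft F k + LinearMap.mulRight F k)
  refine symPart_le (P := P) ?_ (fun a ha b hb => ?_) hs
  · change k * 1 + 1 * k ∈ K
    simpa using add_mem hk hk
  · change k * (a * b + b * a) + (a * b + b * a) * k ∈ K
    convert add_mem (hK.tr_mem k hk a ha b hb) (hK.tr_mem k hk b hb a ha) using 1
    noncomm_ring

theorem comm_sym_mem {k s : R} (hk : k ∈ K) (hs : s ∈ symPart K) : k * s - s * k ∈ symPart K := by
  let P : Submodule F R := (symPart K).comap (LinearMap.mulLeft F k - LinearMap.mulRight F k)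
  refine symPart_le (P := P) ?_ (fun a ha b hb => ?_) hs
  · change k * 1 - 1 * k ∈ symPart K
    simp
  · change k * (a * b + b * a) - (a * b + b * a) * k ∈ symPart K
    convert add_mem (anticomm_mem_symPart (hK.br_mem k hk a ha) hb)
      (anticomm_mem_symPart ha (hK.br_mem k hk b hb)) using 1
    noncomm_ring

theorem sym_comm_sym_mem {s t : R} (hs : s ∈ symPart K) (ht : t ∈ symPart K) :
    s * t - t * s ∈ K := by
  let P : Submodule F R := K.comap (LinearMap.mulLeft F s - LinearMap.mulRight F s)
  refine symPart_le (P := P) ?_ (fun a ha b hb => ?_) ht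
  · change s * 1 - 1 * s ∈ K
    simp
  · change s * (a * b + b * a) - (a * b + b * a) * s ∈ K
    convert neg_mem (add_mem (hK.anticomm_sym_mem hb (hK.comm_sym_mem ha hs))
      (hK.anticomm_sym_mem ha (hK.comm_sym_mem hb hs))) using 1
    noncomm_ring

theorem sym_anticomm_sym_mem (hF : (2 : F) ≠ 0) {s t : R} (hs : s ∈ symPart K)
    (ht : t ∈ symPart K) : s * t + t * s ∈ symPart K := by
  let P : Submodule F R := (symPart K).comap (LinearMap.mulLeft F s + LinearMap.mulRight F s)
  refine symPart_le (P := P) ?_ (fun a ha b hb => ?_) ht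
  · change s * 1 + 1 * s ∈ symPart K
    simpa using add_mem hs hs
  · change s * (a * b + b * a) + (a * b + b * a) * s ∈ symPart K
    -- twice the anticommutator is a sum of nested brackets with `a` and `b`
    refine (Submodule.smul_mem_iff _ hF).1 ?_
    convert add_mem (add_mem (anticomm_mem_symPart ha (hK.anticomm_sym_mem hb hs))
      (anticomm_mem_symPart hb (hK.anticomm_sym_mem ha hs)))
      (add_mem (hK.comm_sym_mem ha (hK.comm_sym_mem hb hs))
      (hK.comm_sym_mem hb (hK.comm_sym_mem ha hs))) using 1
    rw [two_smul]
    noncomm_ring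

theorem sup_symPart_eq_top (hF : (2 : F) ≠ 0) (hgen : Algebra.adjoin F (K : Set R) = ⊤) :
    K ⊔ symPart K = ⊤ := by
  have hl : K ≤ K ⊔ symPart K := le_sup_left
  have hr : symPart K ≤ K ⊔ symPart K := le_sup_right
  rw [eq_top_iff]
  intro x _
  have hx : x ∈ Algebra.adjoin F (K : Set R) := hgen ▸ Algebra.mem_top
  induction hx using Algebra.adjoin_induction with
  | mem x hx => exact hl hx
  | algebraMap r =>
    rw [Algebra.algebraMap_eq_smul_one]
    exact Submodule.smul_mem _ _ (hr (one_mem_symPart K))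
  | add x y _ _ hx hy => exact add_mem (hx trivial) (hy trivial)
  | mul x y _ _ hx hy =>
    obtain ⟨k, hk, s, hs, rfl⟩ := Submodule.mem_sup.1 (hx trivial)
    obtain ⟨l, hl', t, ht, rfl⟩ := Submodule.mem_sup.1 (hy trivial)
    rw [add_mul, mul_add, mul_add]
    refine add_mem (add_mem ?_ ?_) (add_mem ?_ ?_)
    · exact mul_mem_of_half hF (hr (anticomm_mem_symPart hk hl')) (hl (hK.br_mem k hk l hl'))
    · exact mul_mem_of_half hF (hl (hK.anticomm_sym_mem hk ht)) (hr (hK.comm_sym_mem hk ht))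
    · refine mul_mem_of_half hF (hl ?_) (hr ?_)
      · rw [add_comm]; exact hK.anticomm_sym_mem hl' hs
      · rw [← neg_sub]; exact neg_mem (hK.comm_sym_mem hl' hs)
    · exact mul_mem_of_half hF (hr (hK.sym_anticomm_sym_mem hF hs ht))
        (hl (hK.sym_comm_sym_mem hs ht))

/-- If `K` meets the span of `1` and its anticommutators trivially, then changing the sign on `K` is
an involution. -/
theorem exists_involution (hF : (2 : F) ≠ 0) (hgen : Algebra.adjoin F (K : Set R) = ⊤)
    (hdisj : Disjoint K (symPart K)) : ∃ σ : AlgInvolution F R, σ.skew = K := by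
  have hc : IsCompl K (symPart K) := ⟨hdisj, codisjoint_iff.2 (hK.sup_symPart_eq_top hF hgen)⟩
  have hdec : ∀ x : R, ∃ k ∈ K, ∃ s ∈ symPart K, k + s = x := fun x =>
    Submodule.mem_sup.1 (hc.sup_eq_top ▸ Submodule.mem_top)
  let f : R →ₗ[F] R := LinearMap.ofIsCompl hc (-K.subtype) (symPart K).subtype
  have hfk : ∀ k ∈ K, f k = -k := fun k hk =>
    LinearMap.ofIsCompl_apply_left hc (⟨k, hk⟩ : K)
  have hfs : ∀ s ∈ symPart K, f s = s := fun s hs =>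
    LinearMap.ofIsCompl_apply_right hc (⟨s, hs⟩ : symPart K)
  have half : ∀ x y : R, f (x * y + y * x) = f x * f y + f y * f x →
      f (x * y - y * x) = f y * f x - f x * f y → f (x * y) = f y * f x := fun x y h1 h2 => by
    refine smul_right_injective R hF ?_
    simp only
    rw [← map_smul, show (2 : F) • (x * y) = (x * y + y * x) + (x * y - y * x) by
      rw [two_smul]; abel, map_add, h1, h2, two_smul]
    abel
  refine ⟨⟨f, fun x y => ?_, fun x => ?_⟩, ?_⟩
  · obtain ⟨k, hk, s, hs, rfl⟩ := hdec x
    obtain ⟨l, hl, t, ht, rfl⟩ := hdec y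
    have e1 : f (k * l) = f l * f k := half _ _
      (by rw [hfs _ (anticomm_mem_symPart hk hl), hfk k hk, hfk l hl]; noncomm_ring)
      (by rw [hfk _ (hK.br_mem k hk l hl), hfk k hk, hfk l hl]; noncomm_ring)
    have e2 : f (k * t) = f t * f k := half _ _
      (by rw [hfk _ (hK.anticomm_sym_mem hk ht), hfk k hk, hfs t ht]; noncomm_ring)
      (by rw [hfs _ (hK.comm_sym_mem hk ht), hfk k hk, hfs t ht]; noncomm_ring)
    have e3 : f (s * l) = f l * f s := half _ _
      (by rw [add_comm (s * l), hfk _ (hK.anticomm_sym_mem hl hs), hfk l hl, hfs s hs]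
          noncomm_ring)
      (by rw [← neg_sub (l * s), map_neg, hfs _ (hK.comm_sym_mem hl hs), hfk l hl, hfs s hs]
          noncomm_ring)
    have e4 : f (s * t) = f t * f s := half _ _
      (by rw [hfs _ (hK.sym_anticomm_sym_mem hF hs ht), hfs s hs, hfs t ht])
      (by rw [hfk _ (hK.sym_comm_sym_mem hs ht), hfs s hs, hfs t ht]; noncomm_ring)
    simp only [add_mul, mul_add, map_add, e1, e2, e3, e4]
    abel
  · obtain ⟨k, hk, s, hs, rfl⟩ := hdec x
    simp only [map_add, hfk k hk, hfs s hs, map_neg, neg_neg]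
  · ext x
    rw [AlgInvolution.mem_skew]
    refine ⟨fun hx => ?_, fun hx => hfk x hx⟩
    obtain ⟨k, hk, s, hs, rfl⟩ := hdec x
    simp only [map_add, hfk k hk, hfs s hs] at hx
    have h2 : (2 : F) • s = 0 := by
      rw [two_smul]
      have := congrArg (fun z => z + k + s) hx
      simpa [add_assoc, add_comm, add_left_comm] using this
    rw [(smul_eq_zero.1 h2).resolve_left hF, add_zero]
    exact hk

/-- If the anticommutators of `K` together with `1` span a simple ring, then `K` is all of it, being
a nonzero ideal. -/
theorem eq_top_of_symPart_eq_top [IsSimpleRing R] (hF : (2 : F) ≠ 0) (hs : symPart K = ⊤)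
    (hne : K ≠ ⊥) : K = ⊤ := by
  have hmem : ∀ x : R, x ∈ symPart K := fun x => hs ▸ Submodule.mem_top
  let I : TwoSidedIdeal R := TwoSidedIdeal.mk' (K : Set R) K.zero_mem K.add_mem K.neg_mem
    (fun {x y} hy => mul_mem_of_half hF
      (by rw [add_comm]; exact hK.anticomm_sym_mem hy (hmem x))
      (hK.sym_comm_sym_mem (hmem x) (hmem y)))
    (fun {x y} hx => mul_mem_of_half hF (hK.anticomm_sym_mem hx (hmem y))
      (hK.sym_comm_sym_mem (hmem x) (hmem y)))
  have hI : ∀ x, x ∈ I ↔ x ∈ K := fun x => by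
    rw [TwoSidedIdeal.mem_mk']; rfl
  rcases eq_bot_or_eq_top I with h | h
  · refine absurd ((Submodule.eq_bot_iff _).2 fun x hx => ?_) hne
    rw [← hI, h] at hx
    exact (TwoSidedIdeal.mem_bot R).1 hx
  · refine eq_top_iff.2 fun x _ => ?_
    rw [← hI, h]
    trivial

end IsClosedLJ

end Symmetric

theorem IsSpecialization.isClosedLJ_range {L : LieJordan F A} {R : Type*} [Ring R] [Algebra F R]
    {ρ : A →ₗ[F] R} (hρ : L.IsSpecialization ρ) : IsClosedLJ (LinearMap.range ρ) where
  br_mem := by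
    rintro _ ⟨x, rfl⟩ _ ⟨y, rfl⟩
    exact ⟨L.br x y, hρ.map_br x y⟩
  tr_mem := by
    rintro _ ⟨x, rfl⟩ _ ⟨y, rfl⟩ _ ⟨z, rfl⟩
    exact ⟨L.tr x y z, hρ.map_tr x y z⟩

/-- The elements that a specialization sends into the symmetric part form an ideal. -/
theorem IsSpecialization.isIdeal_comap_symPart {L : LieJordan F A} (hF : (2 : F) ≠ 0)
    {R : Type*} [Ring R] [Algebra F R] {ρ : A →ₗ[F] R} (hρ : L.IsSpecialization ρ) :
    L.IsIdeal ((symPart (LinearMap.range ρ)).comap ρ) := by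
  have hK := hρ.isClosedLJ_range
  have hm : ∀ x, ρ x ∈ LinearMap.range ρ := fun x => ⟨x, rfl⟩
  have hbr : ∀ x y, ρ y ∈ symPart (LinearMap.range ρ) →
      ρ (L.br x y) ∈ symPart (LinearMap.range ρ) := fun x y hy => by
    rw [hρ.map_br]
    exact hK.comm_sym_mem (hm x) hy
  have hbl : ∀ x y, ρ x ∈ symPart (LinearMap.range ρ) →
      ρ (L.br x y) ∈ symPart (LinearMap.range ρ) := fun x y hx => by
    rw [L.br_skew, map_neg]
    exact neg_mem (hbr y x hx)
  have htl : ∀ x y z, ρ x ∈ symPart (LinearMap.range ρ) →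
      ρ (L.tr x y z) ∈ symPart (LinearMap.range ρ) := fun x y z hx => by
    have h1 : ρ y * ρ x + ρ x * ρ y ∈ LinearMap.range ρ := hK.anticomm_sym_mem (hm y) hx
    have h2 := hbl _ z (hbl x y hx)
    rw [hρ.map_br, hρ.map_br] at h2
    refine (Submodule.smul_mem_iff _ hF).1 ?_
    rw [hρ.map_tr, two_smul]
    convert add_mem (anticomm_mem_symPart h1 (hm z)) h2 using 1
    noncomm_ring
  refine ⟨hbl, hbr, htl, fun x y z hy => ?_, fun x y z hz => ?_⟩
  · have h := L.br_br y x z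
    have : L.tr x y z = L.tr y x z - L.br (L.br y x) z := by rw [h]; abel
    rw [this]
    exact sub_mem (htl y x z hy) (hbl _ z (hbl y x hy))
  · rw [L.tr_symm]
    exact htl z y x hz

/-- A simple Lie-Jordan algebra that generates a simple ring is either the whole ring or the space of
skew elements of an involution. -/
theorem IsSimple.range_eq_top_or_skew {L : LieJordan F A} (hL : L.IsSimple) (hF : (2 : F) ≠ 0)
    {R : Type*} [Ring R] [Algebra F R] [IsSimpleRing R] {ρ : A →ₗ[F] R}
    (hρ : L.IsSpecialization ρ) (hinj : Function.Injective ρ)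
    (hgen : Algebra.adjoin F (Set.range ρ) = ⊤) :
    LinearMap.range ρ = ⊤ ∨ ∃ σ : AlgInvolution F R, σ.skew = LinearMap.range ρ := by
  have hK := hρ.isClosedLJ_range
  rw [← LinearMap.coe_range] at hgen
  rcases hL.eq_bot_or_eq_top _ (hρ.isIdeal_comap_symPart hF) with h | h
  · refine Or.inr (hK.exists_involution hF hgen ?_)
    rw [Submodule.disjoint_def]
    rintro _ ⟨x, rfl⟩ hx
    have : x ∈ (symPart (LinearMap.range ρ)).comap ρ := hx
    rw [h, Submodule.mem_bot] at this
    rw [this, map_zero]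
  · have hle : LinearMap.range ρ ≤ symPart (LinearMap.range ρ) := by
      rintro _ ⟨x, rfl⟩
      have : x ∈ (symPart (LinearMap.range ρ)).comap ρ := h ▸ Submodule.mem_top
      exact this
    refine Or.inl (hK.eq_top_of_symPart_eq_top hF ?_ ?_)
    · rw [← hK.sup_symPart_eq_top hF hgen, sup_eq_right.2 hle]
    · rw [Ne, LinearMap.range_eq_bot]
      rintro rfl
      have h : ∀ x y : A, x = y := fun x y => hinj rfl
      rcases hL.nonzero with ⟨x, y, h'⟩ | ⟨x, y, z, h'⟩ <;> exact h' (h _ _)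

theorem IsSpecialization.isomorphic_ofAssoc {L : LieJordan F A} {R : Type*} [Ring R] [Algebra F R]
    {ρ : A →ₗ[F] R} (hρ : L.IsSpecialization ρ) (hinj : Function.Injective ρ)
    (htop : LinearMap.range ρ = ⊤) : L.Isomorphic (ofAssoc F R) :=
  ⟨LinearEquiv.ofBijective ρ ⟨hinj, LinearMap.range_eq_top.1 htop⟩, hρ.map_br, hρ.map_tr⟩

theorem IsSpecialization.isomorphic_K {L : LieJordan F A} {R : Type*} [Ring R] [Algebra F R]
    {ρ : A →ₗ[F] R} (hρ : L.IsSpecialization ρ) (hinj : Function.Injective ρ)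
    {σ : AlgInvolution F R} (hσ : σ.skew = LinearMap.range ρ) : L.Isomorphic σ.K := by
  refine ⟨(LinearEquiv.ofInjective ρ hinj).trans (LinearEquiv.ofEq _ _ hσ.symm), ?_, ?_⟩
  · intro x y
    exact Subtype.ext (hρ.map_br x y)
  · intro x y z
    exact Subtype.ext (hρ.map_tr x y z)

end LieJordan

/-! ### Symmetric and symplectic normal forms -/

open Matrix in
/-- Two bilinear forms on `Fⁿ` with the same Gram matrix in suitable bases are congruent. -/
theorem Matrix.exists_congruence_of_basis {F : Type*} [Field F] {n : ℕ} {ι : Type*} [Fintype ι]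
    [DecidableEq ι] (m : Matrix (Fin n) (Fin n) F) (h : Matrix ι ι F)
    (v : Module.Basis ι F (Fin n → F)) (hv : ∀ i j, Matrix.toBilin' m (v i) (v j) = h i j) :
    ∃ (s : Matrix ι (Fin n) F) (s' : Matrix (Fin n) ι F), s * s' = 1 ∧ s' * s = 1 ∧
      m = sᵀ * h * s := by
  refine ⟨v.toMatrix (Pi.basisFun F (Fin n)), (Pi.basisFun F (Fin n)).toMatrix v,
    v.toMatrix_mul_toMatrix_flip _, (Pi.basisFun F (Fin n)).toMatrix_mul_toMatrix_flip _, ?_⟩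
  have h1 := LinearMap.BilinForm.toMatrix_mul_basis_toMatrix v (Pi.basisFun F (Fin n))
    (Matrix.toBilin' m)
  rw [LinearMap.BilinForm.toMatrix_basisFun] at h1
  have h2 : LinearMap.BilinForm.toMatrix v (Matrix.toBilin' m) = h := by
    ext i j
    rw [LinearMap.BilinForm.toMatrix_apply, hv]
  rw [h2] at h1
  rw [h1]
  exact (LinearMap.BilinForm.toMatrix'_toBilin' m).symm

open Matrix in
theorem Matrix.toBilin'_nondegenerate_of_mul_eq_one {F : Type*} [Field F] {n : ℕ}
    {m m' : Matrix (Fin n) (Fin n) F} (h : m' * m = 1) {y : Fin n → F}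
    (hy : ∀ x, Matrix.toBilin' m x y = 0) : y = 0 := by
  have h1 : m *ᵥ y = 0 := by
    refine dotProduct_eq_zero _ fun x => ?_
    rw [dotProduct_comm, ← Matrix.toBilin'_apply', hy]
  rw [← Matrix.one_mulVec y, ← h, ← Matrix.mulVec_mulVec, h1, Matrix.mulVec_zero]

open Matrix in
theorem Matrix.toBilin'_swap {F : Type*} [Field F] {n : ℕ}
    (m : Matrix (Fin n) (Fin n) F) (x y : Fin n → F) :
    Matrix.toBilin' mᵀ x y = Matrix.toBilin' m y x := by
  rw [Matrix.toBilin'_apply', Matrix.toBilin'_apply', Matrix.mulVec_transpose,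
    dotProduct_comm, ← Matrix.dotProduct_mulVec]

open Matrix in
/-- An invertible symmetric matrix over an algebraically closed field of characteristic not `2` is
congruent to the identity. -/
theorem Matrix.exists_congruence_of_symm {F : Type*} [Field F] [IsAlgClosed F] (hF : (2 : F) ≠ 0)
    {n : ℕ} {m m' : Matrix (Fin n) (Fin n) F} (h : m' * m = 1) (hm : mᵀ = m) :
    ∃ (s : Matrix (Fin n) (Fin n) F) (s' : Matrix (Fin n) (Fin n) F), s * s' = 1 ∧ s' * s = 1 ∧
      m = sᵀ * 1 * s := by
  have : Invertible (2 : F) := invertibleOfNonzero hF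
  have hsymm : LinearMap.IsSymm (Matrix.toBilin' m) := ⟨fun x y => by
    rw [RingHom.id_apply, ← Matrix.toBilin'_swap, hm]⟩
  obtain ⟨v₀, hv₀⟩ := LinearMap.BilinForm.exists_orthogonal_basis hsymm
  let v := v₀.reindex (finCongr (Module.finrank_fin_fun F (n := n)))
  have hv : ∀ i j, i ≠ j → Matrix.toBilin' m (v i) (v j) = 0 := fun i j hij => by
    simp only [v, Module.Basis.reindex_apply]
    exact hv₀ (by simpa using hij)
  have hd : ∀ i, Matrix.toBilin' m (v i) (v i) ≠ 0 := fun i hi => by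
    refine v.ne_zero i (Matrix.toBilin'_nondegenerate_of_mul_eq_one h fun x => ?_)
    rw [← v.sum_repr x, map_sum, LinearMap.sum_apply]
    refine Finset.sum_eq_zero fun j _ => ?_
    rw [map_smul, LinearMap.smul_apply]
    by_cases hij : j = i
    · rw [hij, hi, smul_zero]
    · rw [hv j i hij, smul_zero]
  choose r hr using fun i => IsAlgClosed.exists_eq_mul_self (Matrix.toBilin' m (v i) (v i))
  have hr0 : ∀ i, r i ≠ 0 := fun i hi => hd i (by rw [hr, hi, zero_mul])
  let w := v.unitsSMul fun i => (Units.mk0 (r i) (hr0 i))⁻¹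
  have hw : ∀ i, w i = (r i)⁻¹ • v i := fun i => by
    simp only [w, Module.Basis.unitsSMul_apply, Units.smul_def, Units.val_inv_eq_inv_val,
      Units.val_mk0]
  refine Matrix.exists_congruence_of_basis m 1 w fun i j => ?_
  rw [hw, hw, map_smul, map_smul, LinearMap.smul_apply, smul_eq_mul, smul_eq_mul]
  by_cases hij : i = j
  · subst hij
    rw [hr, Matrix.one_apply_eq]
    have := hr0 i
    field_simp
  · rw [hv i j hij, Matrix.one_apply_ne hij, mul_zero, mul_zero]

/-- A family of vectors whose Gram matrix is the standard symplectic matrix. -/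
def IsSymplecticFamily {F V : Type*} [Field F] [AddCommGroup V] [Module F V]
    (B : V →ₗ[F] V →ₗ[F] F) {k : ℕ} (w : Fin k ⊕ Fin k → V) : Prop :=
  ∀ i j, B (w i) (w j) = Matrix.J (Fin k) F i j

namespace IsSymplecticFamily

open Matrix

variable {F V : Type*} [Field F] [AddCommGroup V] [Module F V] {B : V →ₗ[F] V →ₗ[F] F} {k : ℕ}
  {w : Fin k ⊕ Fin k → V}

theorem apply_sum (hw : IsSymplecticFamily B w) (c : Fin k ⊕ Fin k → F) (j : Fin k ⊕ Fin k) :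
    B (∑ i, c i • w i) (w j) = (c ᵥ* Matrix.J (Fin k) F) j := by
  rw [map_sum, LinearMap.sum_apply]
  simp only [map_smul, LinearMap.smul_apply, hw _ j, smul_eq_mul]
  rfl

theorem linearIndependent (hw : IsSymplecticFamily B w) : LinearIndependent F w := by
  rw [Fintype.linearIndependent_iff]
  intro c hc
  have h : c ᵥ* Matrix.J (Fin k) F = 0 := by
    ext j
    rw [← hw.apply_sum c j, hc, map_zero, LinearMap.zero_apply, Pi.zero_apply]
  have h2 : c = 0 := by
    have h3 := congrArg (· ᵥ* Matrix.J (Fin k) F) h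
    simpa [Matrix.vecMul_vecMul, Matrix.J_squared, Matrix.vecMul_neg] using h3
  exact fun i => congrFun h2 i

/-- A symplectic family that is too short to span can be extended by a hyperbolic pair in its
orthogonal complement. -/
theorem exists_extend [FiniteDimensional F V] (hw : IsSymplecticFamily B w)
    (hB : ∀ x y, B x y = -B y x) (hB' : ∀ x, B x x = 0)
    (hnd : ∀ x, (∀ y, B x y = 0) → x = 0) (hlt : k + k < Module.finrank F V) :
    ∃ w' : Fin (k + 1) ⊕ Fin (k + 1) → V, IsSymplecticFamily B w' := by
  let φ : V →ₗ[F] (Fin k ⊕ Fin k → F) := LinearMap.pi fun j => B.flip (w j)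
  obtain ⟨x, hx, hx0⟩ := (Submodule.ne_bot_iff _).1
    (LinearMap.ker_ne_bot_of_finrank_lt (f := φ) (by simpa using hlt))
  have hxw : ∀ j, B x (w j) = 0 := fun j => congrFun (LinearMap.mem_ker.1 hx) j
  obtain ⟨y₀, hy₀⟩ : ∃ y, B x y ≠ 0 := by
    by_contra! h
    exact hx0 (hnd x h)
  -- correct `y₀` by a vector in the span so that it becomes orthogonal to the family
  let c : Fin k ⊕ Fin k → F := -((fun j => B y₀ (w j)) ᵥ* Matrix.J (Fin k) F)
  let y₁ := y₀ - ∑ i, c i • w i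
  have hy₁w : ∀ j, B y₁ (w j) = 0 := fun j => by
    simp only [y₁]
    rw [map_sub, LinearMap.sub_apply, hw.apply_sum]
    simp [c, Matrix.neg_vecMul, Matrix.vecMul_vecMul, Matrix.J_squared, Matrix.vecMul_neg]
  have hxy₁ : B x y₁ = B x y₀ := by
    simp [y₁, hxw]
  let y := (-(B x y₀)⁻¹) • y₁
  have hyw : ∀ j, B y (w j) = 0 := fun j => by simp [y, hy₁w]
  have hxy : B x y = -1 := by simp [y, hxy₁, hy₀]
  have hyx : B y x = 1 := by rw [hB, hxy, neg_neg]
  have hwx : ∀ j, B (w j) x = 0 := fun j => by rw [hB, hxw, neg_zero]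
  have hwy : ∀ j, B (w j) y = 0 := fun j => by rw [hB, hyw, neg_zero]
  have h11 : ∀ i j, B (w (.inl i)) (w (.inl j)) = 0 := fun i j => by
    rw [hw]; simp [Matrix.J]
  have h22 : ∀ i j, B (w (.inr i)) (w (.inr j)) = 0 := fun i j => by
    rw [hw]; simp [Matrix.J]
  have h12 : ∀ i j, B (w (.inl i)) (w (.inr j)) = -(1 : Matrix (Fin k) (Fin k) F) i j :=
    fun i j => by rw [hw]; simp [Matrix.J]
  have h21 : ∀ i j, B (w (.inr i)) (w (.inl j)) = (1 : Matrix (Fin k) (Fin k) F) i j :=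
    fun i j => by rw [hw]; simp [Matrix.J]
  refine ⟨Sum.elim (Fin.cons x fun i => w (.inl i)) (Fin.cons y fun i => w (.inr i)), ?_⟩
  rintro (i | i) (j | j) <;> refine Fin.cases ?_ (fun i => ?_) i <;>
    refine Fin.cases ?_ (fun j => ?_) j <;>
    simp [Matrix.J, hxw, hyw, hwx, hwy, hxy, hyx, hB', h11, h22, h12, h21, Matrix.one_apply,
      Fin.succ_ne_zero, (Fin.succ_ne_zero _).symm]

end IsSymplecticFamily

/-- A nondegenerate alternating form has a symplectic basis. -/
theorem exists_symplectic_basis {F V : Type*} [Field F] [AddCommGroup V] [Module F V]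
    [FiniteDimensional F V] (B : V →ₗ[F] V →ₗ[F] F) (hB : ∀ x y, B x y = -B y x)
    (hB' : ∀ x, B x x = 0) (hnd : ∀ x, (∀ y, B x y = 0) → x = 0) :
    ∃ (k : ℕ) (b : Module.Basis (Fin k ⊕ Fin k) F V), IsSymplecticFamily B b := by
  classical
  let Q : ℕ → Prop := fun k => ∃ w : Fin k ⊕ Fin k → V, IsSymplecticFamily B w
  have hbound : ∀ k, Q k → k + k ≤ Module.finrank F V := by
    rintro k ⟨w, hw⟩
    simpa using hw.linearIndependent.fintype_card_le_finrank
  have h0 : Q 0 := ⟨fun i => 0, fun i => (i.elim Fin.elim0 Fin.elim0)⟩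
  -- a symplectic family of maximal length
  let k := Nat.findGreatest Q (Module.finrank F V)
  obtain ⟨w, hw⟩ : Q k := Nat.findGreatest_spec (Nat.zero_le _) h0
  have hcard : k + k = Module.finrank F V := by
    refine le_antisymm (hbound k ⟨w, hw⟩) (not_lt.1 fun hlt => ?_)
    have h1 := hw.exists_extend hB hB' hnd hlt
    have h2 := hbound _ h1
    have h3 : k + 1 ≤ k := Nat.le_findGreatest (by omega) h1
    omega
  refine ⟨k, basisOfLinearIndependentOfCardEqFinrank' w hw.linearIndependent (by simpa), ?_⟩
  simpa using hw

open Matrix in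
/-- An invertible skew-symmetric matrix over a field of characteristic not `2` is congruent to the
standard symplectic matrix. -/
theorem Matrix.exists_congruence_of_skew {F : Type*} [Field F] (hF : (2 : F) ≠ 0)
    {n : ℕ} {m m' : Matrix (Fin n) (Fin n) F} (h : m' * m = 1) (hm : mᵀ = -m) :
    ∃ (k : ℕ) (s : Matrix (Fin k ⊕ Fin k) (Fin n) F) (s' : Matrix (Fin n) (Fin k ⊕ Fin k) F),
      s * s' = 1 ∧ s' * s = 1 ∧ m = sᵀ * Matrix.J (Fin k) F * s := by
  have hB : ∀ x y, Matrix.toBilin' m x y = -Matrix.toBilin' m y x := fun x y => by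
    rw [← Matrix.toBilin'_swap, hm, map_neg]; rfl
  have hB' : ∀ x, Matrix.toBilin' m x x = 0 := fun x => by
    have h := hB x x
    rw [eq_neg_iff_add_eq_zero, ← two_mul] at h
    exact (mul_eq_zero.1 h).resolve_left hF
  obtain ⟨k, b, hb⟩ := exists_symplectic_basis (Matrix.toBilin' m) hB hB' fun x hx =>
    Matrix.toBilin'_nondegenerate_of_mul_eq_one h fun y => by rw [hB, hx, neg_zero]
  exact ⟨k, Matrix.exists_congruence_of_basis m _ b hb⟩

/-! ### Involutions of matrix algebras and the classification -/

open Matrix in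
/-- Every automorphism of a matrix algebra over a field is inner. -/
theorem Matrix.exists_conj_of_algEquiv {F : Type*} [Field F] {n : ℕ}
    (f : Matrix (Fin n) (Fin n) F ≃ₐ[F] Matrix (Fin n) (Fin n) F) :
    ∃ g g' : Matrix (Fin n) (Fin n) F, g * g' = 1 ∧ g' * g = 1 ∧ ∀ x, f x = g * x * g' := by
  let e : Module.End F (Fin n → F) ≃ₐ[F] Matrix (Fin n) (Fin n) F := LinearMap.toMatrixAlgEquiv'
  obtain ⟨T, hT⟩ := AlgEquiv.eq_linearEquivConjAlgEquiv ((e.trans f).trans e.symm)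
  let t : Module.End F (Fin n → F) := T.toLinearMap
  let t' : Module.End F (Fin n → F) := T.symm.toLinearMap
  have h1 : t * t' = 1 := LinearMap.ext fun x => T.apply_symm_apply x
  have h2 : t' * t = 1 := LinearMap.ext fun x => T.symm_apply_apply x
  refine ⟨e t, e t', by rw [← map_mul, h1, map_one], by rw [← map_mul, h2, map_one], fun x => ?_⟩
  have h3 : e.symm (f (e (e.symm x))) = t * e.symm x * t' := AlgEquiv.congr_fun hT (e.symm x)
  rw [AlgEquiv.apply_symm_apply] at h3
  rw [← AlgEquiv.apply_symm_apply e (f x), h3, map_mul, map_mul, AlgEquiv.apply_symm_apply]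

open Matrix in
/-- An involution of a matrix algebra is the adjoint involution of a symmetric or skew-symmetric
form. -/
theorem AlgInvolution.exists_form {F : Type*} [Field F] {n : ℕ} (hn : 1 ≤ n)
    (σ : AlgInvolution F (Matrix (Fin n) (Fin n) F)) :
    ∃ m m' : Matrix (Fin n) (Fin n) F, m * m' = 1 ∧ m' * m = 1 ∧ (mᵀ = m ∨ mᵀ = -m) ∧
      ∀ x, σ.map x = m' * xᵀ * m := by
  have h1 : σ.map 1 = 1 := by
    have := σ.map_mul (σ.map 1) 1
    rwa [mul_one, σ.map_map, mul_one, eq_comm] at this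
  -- composing with the transposition gives an automorphism
  let f₀ : Matrix (Fin n) (Fin n) F →ₐ[F] Matrix (Fin n) (Fin n) F :=
    AlgHom.ofLinearMap ((transposeInvolution F n).map ∘ₗ σ.map)
      (by
        change (σ.map 1)ᵀ = 1
        rw [h1, Matrix.transpose_one])
      (fun x y => by
        change (σ.map (x * y))ᵀ = (σ.map x)ᵀ * (σ.map y)ᵀ
        rw [σ.map_mul, Matrix.transpose_mul])
  have hf₀ : ∀ x, f₀ x = (σ.map x)ᵀ := fun x => rfl
  let f := AlgEquiv.ofBijective f₀ ⟨fun x y hxy => by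
      rw [hf₀, hf₀, Matrix.transpose_inj] at hxy
      rw [← σ.map_map x, hxy, σ.map_map],
    fun y => ⟨σ.map yᵀ, by rw [hf₀, σ.map_map, Matrix.transpose_transpose]⟩⟩
  obtain ⟨g, g', hgg', hg'g, hf⟩ := Matrix.exists_conj_of_algEquiv f
  have hσ : ∀ x, σ.map x = g'ᵀ * xᵀ * gᵀ := fun x => by
    have := congrArg Matrix.transpose ((hf₀ x).symm.trans (hf x))
    rw [Matrix.transpose_transpose] at this
    rw [this, Matrix.transpose_mul, Matrix.transpose_mul, mul_assoc]
  have ht : g'ᵀ * gᵀ = 1 := by rw [← Matrix.transpose_mul, hgg', Matrix.transpose_one]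
  have ht' : gᵀ * g'ᵀ = 1 := by rw [← Matrix.transpose_mul, hg'g, Matrix.transpose_one]
  -- since `σ` is involutive, `g'ᵀ * g` is central
  have hcomm : ∀ x, Commute (g'ᵀ * g) x := fun x => by
    have h2 := σ.map_map x
    rw [hσ, hσ] at h2
    simp only [Matrix.transpose_mul, Matrix.transpose_transpose] at h2
    change g'ᵀ * g * x = x * (g'ᵀ * g)
    calc g'ᵀ * g * x = g'ᵀ * (g * (x * g')) * ((gᵀ * g'ᵀ) * g) := by
          rw [ht', one_mul]
          simp only [mul_assoc, hg'g, mul_one]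
      _ = (g'ᵀ * (g * (x * g')) * gᵀ) * (g'ᵀ * g) := by simp only [mul_assoc]
      _ = x * (g'ᵀ * g) := by rw [h2]
  obtain ⟨r, hr⟩ := Matrix.mem_range_scalar_of_commute_single (M := g'ᵀ * g)
    fun i j _ => (hcomm _).symm
  have hg : g = r • gᵀ := by
    calc g = (gᵀ * g'ᵀ) * g := by rw [ht', one_mul]
      _ = gᵀ * Matrix.scalar (Fin n) r := by rw [hr, mul_assoc]
      _ = r • gᵀ := by simp [← Matrix.smul_one_eq_diagonal]
  have hgT : gᵀ = r • g := by
    conv_lhs => rw [hg]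
    rw [Matrix.transpose_smul, Matrix.transpose_transpose]
  have hg0 : g ≠ 0 := by
    rintro rfl
    have : Nonempty (Fin n) := ⟨⟨0, hn⟩⟩
    rw [zero_mul] at hgg'
    exact zero_ne_one hgg'
  have hr2 : r * r = 1 := by
    have h3 : (r * r - 1) • g = 0 := by
      rw [sub_smul, mul_smul, ← hgT, ← hg, one_smul, sub_self]
    exact sub_eq_zero.1 ((smul_eq_zero.1 h3).resolve_right hg0)
  refine ⟨gᵀ, g'ᵀ, ht', ht, ?_, hσ⟩
  rw [Matrix.transpose_transpose]
  rcases mul_self_eq_one_iff.1 hr2 with h | h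
  · left; rw [hgT, h, one_smul]
  · right; rw [hgT, h, neg_one_smul, neg_neg]

namespace LieJordan

variable {F : Type*} {A : Type*} [Field F] [AddCommGroup A] [Module F A]

open Matrix in
/-- Congruent forms have isomorphic algebras of skew elements. -/
theorem IsSpecialization.isomorphic_K_of_congruence {L : LieJordan F A} {n : ℕ}
    {ρ : A →ₗ[F] Matrix (Fin n) (Fin n) F} (hρ : L.IsSpecialization ρ)
    (hinj : Function.Injective ρ) {σ : AlgInvolution F (Matrix (Fin n) (Fin n) F)}
    (hσ : σ.skew = LinearMap.range ρ) {m m' : Matrix (Fin n) (Fin n) F} (hm : m * m' = 1)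
    (hσm : ∀ x, σ.map x = m' * xᵀ * m) {ι : Type*} [Fintype ι] [DecidableEq ι]
    {s : Matrix ι (Fin n) F} {s' : Matrix (Fin n) ι F} (hss' : s * s' = 1) (hs's : s' * s = 1)
    {h h' : Matrix ι ι F} (hh : h' * h = 1) (hms : m = sᵀ * h * s)
    (τ : AlgInvolution F (Matrix ι ι F)) (hτ : ∀ y, τ.map y = h' * yᵀ * h) :
    L.Isomorphic τ.K := by
  have hst : s'ᵀ * sᵀ = 1 := by rw [← Matrix.transpose_mul, hss', Matrix.transpose_one]
  have hst' : sᵀ * s'ᵀ = 1 := by rw [← Matrix.transpose_mul, hs's, Matrix.transpose_one]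
  have hm' : s * m' = h' * s'ᵀ := by
    calc s * m' = h' * (s'ᵀ * (sᵀ * h * s) * m') := by
          rw [Matrix.mul_assoc sᵀ, ← Matrix.mul_assoc s'ᵀ, hst, Matrix.one_mul, Matrix.mul_assoc h,
            ← Matrix.mul_assoc h', hh, Matrix.one_mul]
      _ = h' * s'ᵀ := by rw [← hms, Matrix.mul_assoc, hm, Matrix.mul_one]
  have hm2 : m * s' = sᵀ * h := by
    rw [hms, Matrix.mul_assoc, hss', Matrix.mul_one]
  have hcancel : ∀ (x y : Matrix (Fin n) (Fin n) F), s * x * s' * (s * y * s') = s * (x * y) * s' :=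
    fun x y => by
      calc s * x * s' * (s * y * s') = s * x * (s' * s) * (y * s') := by
            simp only [Matrix.mul_assoc]
        _ = _ := by rw [hs's]; simp only [Matrix.mul_assoc, Matrix.one_mul]
  let φ : Matrix (Fin n) (Fin n) F →ₐ[F] Matrix ι ι F :=
    AlgHom.ofLinearMap
      { toFun := fun x => s * x * s'
        map_add' := fun x y => by rw [Matrix.mul_add, Matrix.add_mul]
        map_smul' := fun c x => by simp }
      (by change s * (1 : Matrix (Fin n) (Fin n) F) * s' = 1; rw [Matrix.mul_one, hss'])
      (fun x y => (hcancel x y).symm)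
  have hφ : ∀ x, φ x = s * x * s' := fun _ => rfl
  have hback : ∀ x, s' * φ x * s = x := fun x => by
    calc s' * φ x * s = (s' * s) * x * (s' * s) := by rw [hφ]; simp only [Matrix.mul_assoc]
      _ = x := by rw [hs's, Matrix.one_mul, Matrix.mul_one]
  have hforth : ∀ y : Matrix ι ι F, φ (s' * y * s) = y := fun y => by
    calc φ (s' * y * s) = (s * s') * y * (s * s') := by rw [hφ]; simp only [Matrix.mul_assoc]
      _ = y := by rw [hss', Matrix.one_mul, Matrix.mul_one]
  have hφinj : Function.Injective φ := fun x y hxy => by rw [← hback x, hxy, hback]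
  have hφσ : ∀ x, φ (σ.map x) = τ.map (φ x) := fun x => by
    calc φ (σ.map x) = (s * m') * xᵀ * (m * s') := by
          rw [hφ, hσm]; simp only [Matrix.mul_assoc]
      _ = τ.map (φ x) := by
          rw [hm', hm2, hτ, hφ, Matrix.transpose_mul, Matrix.transpose_mul]
          simp only [Matrix.mul_assoc]
  refine (hρ.comp_algHom φ).isomorphic_K (hφinj.comp hinj) ?_
  ext y
  rw [AlgInvolution.mem_skew, LinearMap.range_comp, ← hσ]
  constructor
  · intro hy
    refine ⟨s' * y * s, ?_, hforth y⟩
    refine hφinj ?_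
    rw [hφσ, hforth, hy, map_neg, hforth]
  · rintro ⟨x, hx, rfl⟩
    have hx' : σ.map x = -x := hx
    change τ.map (φ x) = -φ x
    rw [← hφσ, hx', map_neg]

/-- If the bracket of a specialized algebra vanishes, the ring it generates is commutative. -/
theorem IsSpecialization.commute_of_br_eq_zero {L : LieJordan F A} {R : Type*} [Ring R]
    [Algebra F R] {ρ : A →ₗ[F] R} (hρ : L.IsSpecialization ρ)
    (hgen : Algebra.adjoin F (Set.range ρ) = ⊤) (hbr : ∀ x y, L.br x y = 0) (a b : R) :
    a * b = b * a := by
  have h1 : Set.range ρ ⊆ Subalgebra.center F R := by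
    have h2 : Algebra.adjoin F (Set.range ρ) ≤ Subalgebra.centralizer F (Set.range ρ) := by
      refine Algebra.adjoin_le ?_
      rintro _ ⟨x, rfl⟩
      refine (Subalgebra.mem_centralizer_iff F).2 ?_
      rintro _ ⟨y, rfl⟩
      have := hρ.map_br y x
      rw [hbr, map_zero, eq_comm, sub_eq_zero] at this
      exact this
    rintro _ ⟨x, rfl⟩
    refine Subalgebra.mem_center_iff.2 fun r => ?_
    have h3 : r ∈ Subalgebra.centralizer F (Set.range ρ) := h2 (hgen ▸ Algebra.mem_top)
    exact ((Subalgebra.mem_centralizer_iff F).1 h3 _ ⟨x, rfl⟩).symm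
  have h4 : a ∈ Subalgebra.center F R := Algebra.adjoin_le h1 (hgen ▸ Algebra.mem_top)
  exact ((Subalgebra.mem_center_iff.1 h4) b).symm

/-- Skew-symmetric matrices of size at most two commute with each other. -/
theorem skew_transpose_mul_comm (hF : (2 : F) ≠ 0) {n : ℕ} (hn : n ≤ 2)
    {a b : Matrix (Fin n) (Fin n) F} (ha : a.transpose = -a) (hb : b.transpose = -b) :
    a * b = b * a := by
  have hdiag : ∀ c : Matrix (Fin n) (Fin n) F, c.transpose = -c → ∀ i, c i i = 0 :=
    fun c hc i => by
      have h : c i i = -c i i := congrFun (congrFun hc i) i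
      rw [eq_neg_iff_add_eq_zero, ← two_mul] at h
      exact (mul_eq_zero.1 h).resolve_left hF
  ext i j
  rw [Matrix.mul_apply, Matrix.mul_apply]
  interval_cases n
  · exact i.elim0
  · fin_cases i, j
    simp [hdiag a ha]
  · have h1 : a 0 1 = -a 1 0 := congrFun (congrFun ha 1) 0
    have h2 : b 0 1 = -b 1 0 := congrFun (congrFun hb 1) 0
    fin_cases i <;> fin_cases j <;>
      simp [hdiag a ha, hdiag b hb, h1, h2, mul_comm (b 1 0) (a 1 0)]

/-- A simple Lie-Jordan algebra that generates `Mₙ(F)` is not the space of skew-symmetric matrices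
of size at most two: that space generates only a commutative ring. -/
theorem IsSimple.two_lt_of_isomorphic_transpose {L : LieJordan F A} (hL : L.IsSimple)
    (hF : (2 : F) ≠ 0) {n : ℕ} (hn : 1 ≤ n)
    {ρ : A →ₗ[F] Matrix (Fin n) (Fin n) F} (hρ : L.IsSpecialization ρ)
    (hgen : Algebra.adjoin F (Set.range ρ) = ⊤)
    (h : L.Isomorphic (transposeInvolution F n).K) : 2 < n := by
  by_contra! hle
  obtain ⟨e, hebr, hetr⟩ := h
  have hskew : ∀ x, (e x : Matrix (Fin n) (Fin n) F).transpose = -(e x) := fun x => (e x).2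
  have hbr : ∀ x y, L.br x y = 0 := fun x y => by
    refine e.injective (Subtype.ext ?_)
    rw [hebr, map_zero, AlgInvolution.K_br,
      skew_transpose_mul_comm hF hle (hskew x) (hskew y), sub_self]
    rfl
  have hcomm := hρ.commute_of_br_eq_zero hgen hbr
  interval_cases n
  · have hz : ∀ x : A, x = 0 := fun x => by
      refine e.injective (Subtype.ext ?_)
      rw [map_zero]
      ext i j
      have h1 : (e x : Matrix (Fin 1) (Fin 1) F) j i = -(e x : Matrix (Fin 1) (Fin 1) F) i j :=
        congrFun (congrFun (hskew x) i) j
      rw [Subsingleton.elim j i, eq_neg_iff_add_eq_zero, ← two_mul] at h1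
      rw [Subsingleton.elim j i]
      exact (mul_eq_zero.1 h1).resolve_left hF
    rcases hL.nonzero with ⟨x, y, h'⟩ | ⟨x, y, z, h'⟩ <;> exact h' (hz _)
  · have h1 := congrFun (congrFun (hcomm (Matrix.single 0 1 1) (Matrix.single 1 0 1)) 0) 0
    simp at h1

end LieJordan

theorem mainTheorem5 {F : Type*} [Field F] [IsAlgClosed F] (hF : (2 : F) ≠ 0)
    {A : Type*} [AddCommGroup A] [Module F A] [FiniteDimensional F A]
    (L : LieJordan F A) (hL : L.IsSimple) :
    (∃ n : ℕ, 2 < n ∧ L.Isomorphic (transposeInvolution F n).K) ∨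
    (∃ n : ℕ, 1 ≤ n ∧ L.Isomorphic (symplecticInvolution F n).K) ∨
    (∃ n : ℕ, 1 ≤ n ∧ L.Isomorphic (LieJordan.ofAssoc F (Matrix (Fin n) (Fin n) F))) := by
  obtain ⟨n, ρ, hn, hρ, hinj, hgen⟩ := hL.exists_matrix_specialization hF
  have : Nonempty (Fin n) := ⟨⟨0, hn⟩⟩
  rcases hL.range_eq_top_or_skew hF hρ hinj hgen with htop | ⟨σ, hσ⟩
  · exact Or.inr (Or.inr ⟨n, hn, hρ.isomorphic_ofAssoc hinj htop⟩)
  obtain ⟨m, m', hmm', hm'm, hsym | hskew, hσm⟩ := σ.exists_form hn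
  · obtain ⟨s, s', hss', hs's, hms⟩ := Matrix.exists_congruence_of_symm hF hm'm hsym
    have h := hρ.isomorphic_K_of_congruence hinj hσ hmm' hσm hss' hs's (one_mul 1) hms
      (transposeInvolution F n) fun y => by rw [one_mul, mul_one]; rfl
    exact Or.inl ⟨n, hL.two_lt_of_isomorphic_transpose hF hn hρ hgen h, h⟩
  · obtain ⟨k, s, s', hss', hs's, hms⟩ := Matrix.exists_congruence_of_skew hF hm'm hskew
    refine Or.inr (Or.inl ⟨k, ?_, hρ.isomorphic_K_of_congruence hinj hσ hmm' hσm hss' hs's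
      (h' := (Matrix.J (Fin k) F)⁻¹) ?_ hms (symplecticInvolution F k) fun y => rfl⟩)
    · rw [Nat.one_le_iff_ne_zero]
      rintro rfl
      -- a matrix factoring through the zero space cannot be the identity
      have h0 : s' * s = 0 := by
        ext i j
        rw [Matrix.mul_apply]
        exact Finset.sum_eq_zero fun x _ => (x.elim Fin.elim0 Fin.elim0)
      rw [h0] at hs's
      exact zero_ne_one hs's
    · rw [Matrix.J_inv, neg_mul, Matrix.J_squared, neg_neg]
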